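/- **Closed loop.** Let $v_r,\omega_r:[0,\infty)\to\mathbb R$ be reference inputs. The tracking error $X=(x_e,y_e,\theta_e)^T\in\mathbb R^3$ of a unicycle with inputs $u=(u_1,u_2)=(v,\omega)$ satisfies $$\dot X=F(X,t)+G(X)u,\qquad F(X,t)=\begin{bmatrix}v_r\cos\theta_e\\ v_r\sin\theta_e\\ \omega_r\end{bmatrix},\qquad G(X)=\begin{bmatrix}-1&y_e\\0&-x_e\\0&-1\end{bmatrix}.$$ For gains $c_1,c_2,c_3,\gamma>0$, the Jiang–Nijmeijer controller is $\hat u=(\hat u_1,\hat u_2)=(\hat v,\hat\omega)$ with (where $\operatorname{sinc}s=\sin s/s$, $\operatorname{sinc}0=1$) $$\hat\omega(X,t)=\omega_r+\gamma y_ev_r\operatorname{sinc}\theta_e+c_2\gamma\theta_e,\qquad \hat v(X,t)=v_1+c_1(x_e-c_3\hat\omega y_e),$$ $$v_1=v_r\cos\theta_e-c_3v_2y_e+c_3\hat\omega(\hat\omega x_e-v_r\sin\theta_e),$$ $$v_2=\dot\omega_r+\gamma v_r\operatorname{sinc}\theta_e(-\hat\omega x_e+v_r\sin\theta_e)+\gamma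 y_e\dot v_r\operatorname{sinc}\theta_e+(\gamma y_ev_r\operatorname{sinc}'\theta_e+c_2\gamma)(\omega_r-\hat\omega).$$ With $x_1=x_e-c_3\hat\omega(X,t)y_e$ put $$V(X,t)=\tfrac12x_1^2+\tfrac12y_e^2+\tfrac1{2\gamma}\theta_e^2,\qquad \Sigma(X,t)=c_1x_1^2+c_2\theta_e^2+c_3\hat\omega^2(X,t)\,y_e^2.$$ Let $p\in\mathbb N_0$, $T>0$, $\delta_1,\delta_2\ge0$, $\sigma\in(0,1)$, $\epsilon>0$. A closed-loop trajectory started at $t_0\ge0$ consists of finitely or infinitely many event times $t_0<t_1<\cdots$ and a tracking error $X$ such that, for each $k$: * $\hat X$ solves $\dot{\hat X}=F(\hat X,t)+G(\hat X)\hat u(\hat X,t)$ on $[t_k,t_k+T]$ with $\hat X(t_k)=X(t_k)$; * for $i=1,2$, the vector $a_i(k)\in\mathbb R^{p+1}$ minimizes, with $f(a,\tau)=\sum_{j=0}^pa_j\tau^j$, $$\int_0^T\Big(|f(a,\tau)-\hat u_i(\hat X(t_k+\tau),t_k+\tau)|^2+\delta_i|f(a,\tau)|^2\Big)d\tau\quad\text{subject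 to}\quad f(a,0)=\hat u_i(\hat X(t_k),t_k);$$ * between $t_k$ and the next event (or forever, if there is none), $X$ satisfies its dynamics with $u_i(t_k+\tau)=f(a_i(k),\tau)$; * $t_{k+1}=\min\{t>t_k:\ \dot V\ge-\sigma\Sigma(X,t)\text{ and }V(X,t)\ge\epsilon^2\}$, where $\dot V=\frac{\partial V}{\partial t}+\frac{\partial V}{\partial X}(F(X,t)+G(X)u)$ with the $k$-th polynomial input $u$; there is no further event if this set is empty. **Theorem.** Let $M\ge0$, $c>0$ and $c_1,c_2,c_3,\epsilon>0$. There is $\gamma_0>0$ such that the following holds for all $\gamma\ge\gamma_0$, all $\sigma\in(0,1)$, $T>0$, $\delta_1,\delta_2\ge0$, $p\in\mathbb N_0$, and all differentiable $v_r,\omega_r$ such that $|v_r|,|\omega_r|,|\dot v_r|,|\dot\omega_r|\le M$ and $|v_r|\ge c$ on $[0,\infty)$ and $\dot v_r,\dot\omega_r$ are uniformly continuous on $[0,\infty)$ (for instance, $\ddot v_r,\ddot\omega_r$ exist and are bounded). 0. For every $t_0\ge0$ and $X_0\in\mathbb R^3$ there is a closed-loop trajectory started at $t_0$ with $X(t_0)=X_0$.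 1. For every $\rho$ there is $\tau(\rho)>0$ such that for every $t_0\ge0$ and every closed-loop trajectory started at $t_0$ with $\|X(t_0)\|\le\rho$, all inter-event times satisfy $t_{k+1}-t_k\ge\tau(\rho)$. 2. There is $\tau^*>0$, independent of the initial error, such that for every $\rho$ there are $D\ge0$ and $K\in\mathbb N_0$ such that for every $t_0\ge0$ and every closed-loop trajectory started at $t_0$ with $\|X(t_0)\|\le\rho$, one has $t_{k+1}-t_k\ge\tau^*$ whenever $t_k\ge t_0+D$ or $k\ge K$. 3. The tracking error is uniformly ultimately bounded: there is $b>0$ such that for every $\rho$ there is $D\ge0$ such that for every $t_0\ge0$ and every closed-loop trajectory started at $t_0$ with $\|X(t_0)\|\le\rho$, one has $\|X(t)\|\le b$ for all $t\ge t_0+D$. -/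

import Mathlib

open Real Set Filter Topology

noncomputable section

/-- The space of tracking errors `X = (x_e, y_e, θ_e)`, with its Euclidean norm. -/
abbrev ErrState : Type := EuclideanSpace ℝ (Fin 3)

/-- The reference inputs `v_r` and `ω_r`, used at times `t ≥ 0` only. -/
structure RefInputs where
  v : ℝ → ℝ
  ω : ℝ → ℝ

namespace RefInputs

/-- The time derivative of `v_r` (one-sided at `t = 0`). -/
def dv (R : RefInputs) (t : ℝ) : ℝ := derivWithin R.v (Ici 0) t

/-- The time derivative of `ω_r` (one-sided at `t = 0`). -/
def dω (R : RefInputs) (t : ℝ) : ℝ := derivWithin R.ω (Ici 0) t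

/-- The assumption on the reference inputs: they are differentiable, they and their derivatives
are bounded by `M`, and `|v_r|` is bounded below by `c`. -/
structure Admissible (R : RefInputs) (M c : ℝ) : Prop where
  diff_v : DifferentiableOn ℝ R.v (Ici 0)
  diff_ω : DifferentiableOn ℝ R.ω (Ici 0)
  bound_v : ∀ t, 0 ≤ t → |R.v t| ≤ M
  bound_ω : ∀ t, 0 ≤ t → |R.ω t| ≤ M
  bound_dv : ∀ t, 0 ≤ t → |R.dv t| ≤ M
  bound_dω : ∀ t, 0 ≤ t → |R.dω t| ≤ M
  lower_v : ∀ t, 0 ≤ t → c ≤ |R.v t|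

end RefInputs

/-- The design parameters: controller gains, triggering parameters, and the degree, horizon and
penalty weights of the polynomial fit. -/
structure Params where
  c₁ : ℝ
  c₂ : ℝ
  c₃ : ℝ
  γ : ℝ
  σ : ℝ
  ε : ℝ
  T : ℝ
  δ : Fin 2 → ℝ
  p : ℕ

/-- Drift term of the tracking-error dynamics `X' = F(X,t) + G(X) u`. -/
def errF (R : RefInputs) (X : ErrState) (t : ℝ) : ErrState :=
  !₂[R.v t * cos (X 2), R.v t * sin (X 2), R.ω t]

/-- Input matrix of the tracking-error dynamics. -/
def errG (X : ErrState) : Matrix (Fin 3) (Fin 2) ℝ :=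
  !![-1, X 1; 0, -X 0; 0, -1]

/-- Right-hand side `F(X,t) + G(X) u` of the tracking-error dynamics, `u = (v, ω)`. -/
def errField (R : RefInputs) (X : ErrState) (u : Fin 2 → ℝ) (t : ℝ) : ErrState :=
  errF R X t + WithLp.toLp 2 ((errG X).mulVec u)

namespace Params

/-- Angular velocity of the Jiang–Nijmeijer controller. -/
def omegaHat (P : Params) (R : RefInputs) (X : ErrState) (t : ℝ) : ℝ :=
  R.ω t + P.γ * X 1 * R.v t * sinc (X 2) + P.c₂ * P.γ * X 2

/-- The auxiliary signal `v₂`. -/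
def v₂ (P : Params) (R : RefInputs) (X : ErrState) (t : ℝ) : ℝ :=
  R.dω t
    + P.γ * R.v t * sinc (X 2) * (-(P.omegaHat R X t) * X 0 + R.v t * sin (X 2))
    + P.γ * X 1 * R.dv t * sinc (X 2)
    + (P.γ * X 1 * R.v t * deriv sinc (X 2) + P.c₂ * P.γ) * (R.ω t - P.omegaHat R X t)

/-- The auxiliary signal `v₁`. -/
def v₁ (P : Params) (R : RefInputs) (X : ErrState) (t : ℝ) : ℝ :=
  R.v t * cos (X 2) - P.c₃ * P.v₂ R X t * X 1
    + P.c₃ * P.omegaHat R X t * (P.omegaHat R X t * X 0 - R.v t * sin (X 2))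

/-- The shifted longitudinal error `x₁ = x_e - c₃ ω̂(X,t) y_e`. -/
def x₁ (P : Params) (R : RefInputs) (X : ErrState) (t : ℝ) : ℝ :=
  X 0 - P.c₃ * P.omegaHat R X t * X 1

/-- Linear velocity of the Jiang–Nijmeijer controller. -/
def vHat (P : Params) (R : RefInputs) (X : ErrState) (t : ℝ) : ℝ :=
  P.v₁ R X t + P.c₁ * (X 0 - P.c₃ * P.omegaHat R X t * X 1)

/-- The Jiang–Nijmeijer controller `û(X,t) = (v̂, ω̂)`. -/
def uHat (P : Params) (R : RefInputs) (X : ErrState) (t : ℝ) : Fin 2 → ℝ :=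
  ![P.vHat R X t, P.omegaHat R X t]

/-- The Lyapunov function `V(X,t)`. -/
def V (P : Params) (R : RefInputs) (X : ErrState) (t : ℝ) : ℝ :=
  (1 / 2) * P.x₁ R X t ^ 2 + (1 / 2) * X 1 ^ 2 + (1 / (2 * P.γ)) * X 2 ^ 2

/-- The decay rate `Σ(X,t)`. -/
def Sig (P : Params) (R : RefInputs) (X : ErrState) (t : ℝ) : ℝ :=
  P.c₁ * P.x₁ R X t ^ 2 + P.c₂ * X 2 ^ 2 + P.c₃ * P.omegaHat R X t ^ 2 * X 1 ^ 2

/-- The derivative of `V` along the tracking-error dynamics at state `X`, input `u` and time `t`,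
namely `∂V/∂t + ∂V/∂X (F(X,t) + G(X) u)`. -/
def Vdot (P : Params) (R : RefInputs) (X : ErrState) (u : Fin 2 → ℝ) (t : ℝ) : ℝ :=
  derivWithin (fun s => P.V R X s) (Ici 0) t
    + fderiv ℝ (fun Y => P.V R Y t) X (errField R X u t)

/-- The triggering condition: `V' ≥ -σ Σ` and `V ≥ ε²`. -/
def Trigger (P : Params) (R : RefInputs) (X : ErrState) (u : Fin 2 → ℝ) (t : ℝ) : Prop :=
  -P.σ * P.Sig R X t ≤ P.Vdot R X u t ∧ P.ε ^ 2 ≤ P.V R X t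

/-- Coefficients of a polynomial of degree at most `p`. -/
abbrev Coeffs (P : Params) : Type := Fin (P.p + 1) → ℝ

/-- The polynomial `f(a,τ) = ∑_{j=0}^p a_j τ^j`. -/
def poly (P : Params) (a : P.Coeffs) (τ : ℝ) : ℝ :=
  ∑ j, a j * τ ^ (j : ℕ)

/-- The least-squares cost `∫₀ᵀ |f(a,τ) - w(τ)|² + d |f(a,τ)|² dτ` of fitting a signal `w`. -/
def fitCost (P : Params) (d : ℝ) (w : ℝ → ℝ) (a : P.Coeffs) : ℝ :=
  ∫ τ in (0 : ℝ)..P.T, (|P.poly a τ - w τ| ^ 2 + d * |P.poly a τ| ^ 2)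

/-- `a` minimizes the fitting cost for `w` among the polynomials that agree with `w` at `0`. -/
def IsBestFit (P : Params) (d : ℝ) (w : ℝ → ℝ) (a : P.Coeffs) : Prop :=
  P.poly a 0 = w 0 ∧
    ∀ b : P.Coeffs, P.poly b 0 = w 0 → P.fitCost d w a ≤ P.fitCost d w b

end Params

/-- The time interval between the event `k` and the next one: `[t_k, t_{k+1}]` if `k < N`, and
`[t_k, ∞)` if `k = N` is the last event. -/
def arc (N : ℕ∞) (t : ℕ → ℝ) (k : ℕ) : Set ℝ :=
  {s | t k ≤ s ∧ ((k : ℕ∞) < N → s ≤ t (k + 1))}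

/-- A trajectory of the event-triggered closed loop started at time `t₀`. The event times are
`t_0 = t₀ < t_1 < ⋯`, where `t_k` is meaningful for `k ≤ N`, and `N` is infinite if events go on
forever. Nothing excludes that infinitely many events accumulate at a finite time; the values of
`X` outside the union of the arcs are unconstrained. -/
structure ClosedLoop (P : Params) (R : RefInputs) (t₀ : ℝ) where
  /-- number of events after the initial time -/
  N : ℕ∞
  /-- event times -/
  t : ℕ → ℝ
  /-- tracking error -/
  X : ℝ → ErrState
  /-- simulated tracking error, restarted from the true one at each event -/
  Xhat : ℕ → ℝ → ErrState
  /-- coefficients of the two polynomial inputs communicated at each event -/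
  a : ℕ → Fin 2 → P.Coeffs
  t_zero : t 0 = t₀
  /-- the simulated error follows the Jiang–Nijmeijer controller on `[t_k, t_k + T]` -/
  Xhat_init : ∀ k : ℕ, (k : ℕ∞) ≤ N → Xhat k (t k) = X (t k)
  Xhat_ode : ∀ k : ℕ, (k : ℕ∞) ≤ N → ∀ s ∈ Icc (t k) (t k + P.T),
    HasDerivWithinAt (Xhat k) (errField R (Xhat k s) (P.uHat R (Xhat k s) s) s)
      (Icc (t k) (t k + P.T)) s
  /-- the coefficients are obtained by constrained least squares -/
  a_fit : ∀ k : ℕ, (k : ℕ∞) ≤ N → ∀ i : Fin 2,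
    P.IsBestFit (P.δ i) (fun τ => P.uHat R (Xhat k (t k + τ)) (t k + τ) i) (a k i)
  /-- the tracking error is driven by the polynomial inputs between events -/
  X_ode : ∀ k : ℕ, (k : ℕ∞) ≤ N → ∀ s ∈ arc N t k,
    HasDerivWithinAt X (errField R (X s) (fun i => P.poly (a k i) (s - t k)) s) (arc N t k) s
  /-- the next event is the first time after `t_k` at which the triggering condition holds -/
  next_event : ∀ k : ℕ, (k : ℕ∞) < N →
    IsLeast {s | s ∈ arc N t k ∧ t k < s ∧
      P.Trigger R (X s) (fun i => P.poly (a k i) (s - t k)) s} (t (k + 1))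
  /-- after the last event the triggering condition never holds -/
  last_event : ∀ k : ℕ, (k : ℕ∞) = N →
    ∀ s, t k < s → ¬ P.Trigger R (X s) (fun i => P.poly (a k i) (s - t k)) s

end

noncomputable section

/-! Under the exact controller, `V` decays at rate `Sig` (`VdotAt_uHatAt`). For large `γ`, `Sig ≥ α
> 0` wherever `V ≥ ε²` (`exists_SigAt_lower_bound`). The trigger preserves a fraction of this decay:
as long as `V ≥ ε²`, `V` falls at rate at least `σ α`. Hence `V` never exceeds the larger of its
initial value and `ε²`, and drops below `ε²` for good within a time fixed by the initial bound
(`ClosedLoop.V_le`). Sublevel sets of `V` are bounded, which gives ultimate boundedness.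

For the inter-event times, the polynomial input equals `uHat` at the event, so the trigger fails
there with margin `(1 - σ) α`. If `V ≤ m` at the event, then the error, the simulated error, the
fitted signal and hence the optimal coefficients all lie in compact sets depending only on `m`. By
uniform continuity, using up the margin takes a time bounded below in terms of `m`
(`Standing.exists_gap`). The choice `m = ε²` gives the bound independent of the initial error.

Trajectories are built period by period: the simulation by Picard–Lindelöf with a cutoff, the fit by
compactness, the driven error by explicit integration. The pieces are then glued. -/

/-! ### Smoothness of `sinc`. -/

theorem Real.analyticAt_sinc (x : ℝ) : AnalyticAt ℝ sinc x := by
  by_cases hx : x = 0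
  · subst hx
    obtain ⟨p, hp⟩ := (analyticAt_sin : AnalyticAt ℝ sin 0)
    rw [sinc_eq_dslope]
    exact ⟨_, hp.has_fpower_series_dslope_fslope⟩
  · have h : AnalyticAt ℝ (fun y => sin y / y) x :=
      (analyticAt_sin : AnalyticAt ℝ sin x).div analyticAt_id hx
    refine h.congr ?_
    filter_upwards [isOpen_ne.mem_nhds hx] with y hy
    exact (sinc_of_ne_zero hy).symm

@[fun_prop]
theorem Real.contDiff_sinc {n : WithTop ℕ∞} : ContDiff ℝ n sinc :=
  contDiff_iff_contDiffAt.2 fun x => (analyticAt_sinc x).contDiffAt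

@[fun_prop]
theorem Real.contDiff_deriv_sinc {n : WithTop ℕ∞} : ContDiff ℝ n (deriv sinc) :=
  contDiff_iff_contDiffAt.2 fun x => (analyticAt_sinc x).deriv.contDiffAt

@[fun_prop]
theorem Real.continuous_deriv_sinc : Continuous (deriv sinc) :=
  (contDiff_deriv_sinc (n := 0)).continuous

theorem Real.hasDerivAt_sinc (x : ℝ) : HasDerivAt sinc (deriv sinc x) x :=
  (analyticAt_sinc x).differentiableAt.hasDerivAt

theorem Real.mul_sinc (x : ℝ) : x * sinc x = sin x := by
  by_cases hx : x = 0
  · simp [hx]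
  · rw [sinc_of_ne_zero hx]; field_simp

/-! ### The closed loop as functions of the state and the reference values. -/

/-- Values of the reference inputs and of their derivatives. -/
abbrev Signal : Type := ℝ × ℝ × ℝ × ℝ

/-- The values `(v_r, ω_r, v_r', ω_r')` of the reference inputs at time `t`. -/
def RefInputs.signal (R : RefInputs) (t : ℝ) : Signal := (R.v t, R.ω t, R.dv t, R.dω t)

/-- The right-hand side of the tracking-error dynamics as a function of the reference values. -/
def fieldAt (X : ErrState) (u : Fin 2 → ℝ) (q : Signal) : ErrState :=
  !₂[q.1 * cos (X 2) - u 0 + X 1 * u 1, q.1 * sin (X 2) - X 0 * u 1, q.2.1 - u 1]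

/-- Time enters only through `R.signal t`, which stays in a fixed ball. In these variables,
compactness gives estimates uniform in time. -/
theorem errField_eq (R : RefInputs) (X : ErrState) (u : Fin 2 → ℝ) (t : ℝ) :
    errField R X u t = fieldAt X u (R.signal t) := by
  ext i
  fin_cases i <;>
    simp [errField, errF, errG, fieldAt, RefInputs.signal, dotProduct,
      Fin.sum_univ_two] <;> ring

namespace Params

variable (P : Params)

/-- `omegaHat` as a function of the reference values. -/
def omegaHatAt (X : ErrState) (q : Signal) : ℝ :=
  q.2.1 + P.γ * X 1 * q.1 * sinc (X 2) + P.c₂ * P.γ * X 2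

/-- `x₁` as a function of the reference values. -/
def x₁At (X : ErrState) (q : Signal) : ℝ :=
  X 0 - P.c₃ * P.omegaHatAt X q * X 1

/-- `v₂` as a function of the reference values. -/
def v₂At (X : ErrState) (q : Signal) : ℝ :=
  q.2.2.2 + P.γ * q.1 * sinc (X 2) * (-(P.omegaHatAt X q) * X 0 + q.1 * sin (X 2))
    + P.γ * X 1 * q.2.2.1 * sinc (X 2)
    + (P.γ * X 1 * q.1 * deriv sinc (X 2) + P.c₂ * P.γ) * (q.2.1 - P.omegaHatAt X q)

/-- `vHat` as a function of the reference values. -/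
def vHatAt (X : ErrState) (q : Signal) : ℝ :=
  q.1 * cos (X 2) - P.c₃ * P.v₂At X q * X 1
    + P.c₃ * P.omegaHatAt X q * (P.omegaHatAt X q * X 0 - q.1 * sin (X 2))
    + P.c₁ * (X 0 - P.c₃ * P.omegaHatAt X q * X 1)

/-- `uHat` as a function of the reference values. -/
def uHatAt (X : ErrState) (q : Signal) : Fin 2 → ℝ :=
  ![P.vHatAt X q, P.omegaHatAt X q]

/-- `V` as a function of the reference values. -/
def VAt (X : ErrState) (q : Signal) : ℝ :=
  (1 / 2) * P.x₁At X q ^ 2 + (1 / 2) * X 1 ^ 2 + (1 / (2 * P.γ)) * X 2 ^ 2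

/-- `Sig` as a function of the reference values. -/
def SigAt (X : ErrState) (q : Signal) : ℝ :=
  P.c₁ * P.x₁At X q ^ 2 + P.c₂ * X 2 ^ 2 + P.c₃ * P.omegaHatAt X q ^ 2 * X 1 ^ 2

/-- The derivative of `V` along a curve with velocity `f` and reference values `q`. -/
def VRate (X f : ErrState) (q : Signal) : ℝ :=
  P.x₁At X q * (f 0 - P.c₃ * ((q.2.2.2 + P.γ * f 1 * q.1 * sinc (X 2)
      + P.γ * X 1 * q.2.2.1 * sinc (X 2) + P.γ * X 1 * q.1 * (deriv sinc (X 2) * f 2)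
      + P.c₂ * P.γ * f 2) * X 1 + P.omegaHatAt X q * f 1))
    + X 1 * f 1 + (1 / P.γ) * X 2 * f 2

/-- `Vdot` as a function of the reference values. -/
def VdotAt (X : ErrState) (u : Fin 2 → ℝ) (q : Signal) : ℝ :=
  P.VRate X (fieldAt X u q) q

variable (R : RefInputs) (X : ErrState) (t : ℝ)

theorem uHat_eq : P.uHat R X t = P.uHatAt X (R.signal t) := rfl
theorem V_eq : P.V R X t = P.VAt X (R.signal t) := rfl
theorem Sig_eq : P.Sig R X t = P.SigAt X (R.signal t) := rfl

/-- `v₂` is the derivative of `omegaHat` along the controlled flow, so `vHat` is chosen to make `x₁'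
= -c₁ x₁ + ω̂ y`. The cross term cancels against `-y x ω̂ = -x₁ ω̂ y - c₃ ω̂² y²`, and `y v_r sin θ`
cancels against the `θ` part because `θ sinc θ = sin θ`. -/
theorem VdotAt_uHatAt (hγ : P.γ ≠ 0) (q : Signal) :
    P.VdotAt X (P.uHatAt X q) q = - P.SigAt X q := by
  have h := mul_sinc (X 2)
  simp only [VdotAt, VRate, fieldAt, uHatAt, vHatAt, v₂At, SigAt, x₁At]
  simp only [Matrix.cons_val]
  generalize hω : P.omegaHatAt X q = w
  have hw : w = q.2.1 + P.γ * X 1 * q.1 * sinc (X 2) + P.c₂ * P.γ * X 2 := hω.symm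
  have e : (1 / P.γ) * X 2 * (q.2.1 - w) = - X 1 * q.1 * sin (X 2) - P.c₂ * X 2 ^ 2 := by
    rw [hw, ← h]; field_simp; ring
  rw [e]; ring

/-- Chain rule for `V` along a curve. -/
theorem hasDerivWithinAt_V {Y : ℝ → ErrState} {v ω : ℝ → ℝ} {f : ErrState} {v' ω' : ℝ} {S : Set ℝ}
    {s : ℝ} (hY : HasDerivWithinAt Y f S s) (hv : HasDerivWithinAt v v' S s)
    (hω : HasDerivWithinAt ω ω' S s) (hγ : P.γ ≠ 0) (d : ℝ → ℝ × ℝ) :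
    HasDerivWithinAt (fun r => P.VAt (Y r) (v r, ω r, d r)) (P.VRate (Y s) f (v s, ω s, v', ω'))
      S s := by
  have hc : ∀ i, HasDerivWithinAt (fun r => Y r i) (f i) S s :=
    fun i => ((EuclideanSpace.proj (𝕜 := ℝ) i).hasFDerivAt.comp_hasDerivWithinAt s hY)
  have h0 := hc 0
  have h1 := hc 1
  have h2 := hc 2
  have hs : HasDerivWithinAt (fun r => sinc (Y r 2)) (deriv sinc (Y s 2) * f 2) S s :=
    HasDerivAt.comp_hasDerivWithinAt (h₂ := sinc) s (hasDerivAt_sinc (Y s 2)) h2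
  have hO : HasDerivWithinAt (fun r => P.omegaHatAt (Y r) (v r, ω r, d r)) _ S s :=
    (hω.add (((h1.const_mul P.γ).mul hv).mul hs)).add (h2.const_mul (P.c₂ * P.γ))
  have hx : HasDerivWithinAt (fun r => P.x₁At (Y r) (v r, ω r, d r)) _ S s :=
    h0.sub ((hO.const_mul P.c₃).mul h1)
  have hV := (((hx.pow 2).const_mul (1 / 2)).add ((h1.pow 2).const_mul (1 / 2))).add
    ((h2.pow 2).const_mul (1 / (2 * P.γ)))
  refine hV.congr_deriv ?_
  simp only [VRate, x₁At, omegaHatAt, Pi.mul_apply]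
  field_simp
  ring

variable {P R X t} {M c : ℝ}

theorem hasDerivWithinAt_V_curve (hR : R.Admissible M c) (hγ : P.γ ≠ 0) {Y : ℝ → ErrState}
    {f : ErrState} {S : Set ℝ} {s : ℝ} (hY : HasDerivWithinAt Y f S s) (hS : S ⊆ Ici 0)
    (hs : 0 ≤ s) :
    HasDerivWithinAt (fun r => P.V R (Y r) r) (P.VRate (Y s) f (R.signal s)) S s :=
  -- `V` does not depend on the last two reference values, so `dv` and `dω` need not be
  -- differentiable.
  P.hasDerivWithinAt_V hY ((hR.diff_v s hs).hasDerivWithinAt.mono hS)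
    ((hR.diff_ω s hs).hasDerivWithinAt.mono hS) hγ fun r => (R.dv r, R.dω r)

theorem contDiff_VAt_left (q : Signal) {n : WithTop ℕ∞} : ContDiff ℝ n fun Y => P.VAt Y q := by
  unfold VAt x₁At omegaHatAt
  fun_prop

/-- `VRate` is affine in the velocity of the state and the derivatives of the references. The time
part is a constant curve; the state part is a straight line with frozen references. -/
theorem Vdot_eq (hR : R.Admissible M c) (hγ : P.γ ≠ 0) (u : Fin 2 → ℝ) (ht : 0 ≤ t) :
    P.Vdot R X u t = P.VdotAt X u (R.signal t) := by
  have h1 : derivWithin (fun s => P.V R X s) (Ici 0) t = P.VRate X 0 (R.signal t) :=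
    (hasDerivWithinAt_V_curve hR hγ (hasDerivWithinAt_const t (Ici 0) X) subset_rfl
      ht).derivWithin (uniqueDiffOn_Ici 0 t ht)
  have h2 : ∀ h : ErrState, fderiv ℝ (fun Y => P.V R Y t) X h
      = P.VRate X h (R.v t, R.ω t, 0, 0) := by
    intro h
    have hl : HasDerivWithinAt (fun s : ℝ => X + s • h) h univ 0 := by
      simpa using ((hasDerivWithinAt_id (0 : ℝ) univ).smul_const h).const_add X
    have e1 := P.hasDerivWithinAt_V hl (hasDerivWithinAt_const 0 univ (R.v t))
      (hasDerivWithinAt_const 0 univ (R.ω t)) hγ fun _ => (R.dv t, R.dω t)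
    have hd : DifferentiableAt ℝ (fun Y => P.VAt Y (R.signal t)) (X + (0 : ℝ) • h) :=
      (contDiff_VAt_left (n := 1) _).differentiable one_ne_zero _
    have e2 := hd.hasFDerivAt.comp_hasDerivWithinAt (0 : ℝ) hl
    have := e1.hasDerivAt univ_mem |>.unique (e2.hasDerivAt univ_mem)
    rw [zero_smul, add_zero] at this
    exact this.symm
  rw [Vdot, h1, h2, errField_eq]
  simp only [VdotAt, VRate, RefInputs.signal, PiLp.zero_apply, x₁At, omegaHatAt]
  ring

theorem contDiff_omegaHatAt {n : WithTop ℕ∞} :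
    ContDiff ℝ n fun z : ErrState × Signal => P.omegaHatAt z.1 z.2 := by
  unfold omegaHatAt
  fun_prop

theorem contDiff_uHatAt {n : WithTop ℕ∞} :
    ContDiff ℝ n fun z : ErrState × Signal => P.uHatAt z.1 z.2 := by
  rw [contDiff_pi]
  intro i
  have := contDiff_omegaHatAt (P := P) (n := n)
  fin_cases i
  · simp only [uHatAt, vHatAt, v₂At, Fin.zero_eta, Matrix.cons_val]
    fun_prop
  · simpa [uHatAt] using this

theorem contDiff_fieldAt {n : WithTop ℕ∞} :
    ContDiff ℝ n fun z : ErrState × (Fin 2 → ℝ) × Signal => fieldAt z.1 z.2.1 z.2.2 := by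
  rw [contDiff_euclidean]
  intro i
  fin_cases i <;>
    simp only [fieldAt, Fin.zero_eta, Fin.mk_one, Fin.reduceFinMk, Matrix.cons_val] <;> fun_prop

theorem continuous_VAt : Continuous fun z : ErrState × Signal => P.VAt z.1 z.2 := by
  unfold VAt x₁At omegaHatAt
  fun_prop

theorem continuous_SigAt : Continuous fun z : ErrState × Signal => P.SigAt z.1 z.2 := by
  unfold SigAt x₁At omegaHatAt
  fun_prop

theorem continuous_VdotAt :
    Continuous fun z : ErrState × (Fin 2 → ℝ) × Signal => P.VdotAt z.1 z.2.1 z.2.2 := by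
  unfold VdotAt VRate fieldAt x₁At omegaHatAt
  simp only [Matrix.cons_val]
  fun_prop

end Params

/-! ### Lower bound on the decay rate and boundedness of sublevel sets. -/

theorem errState_norm_le (X : ErrState) : ‖X‖ ≤ |X 0| + |X 1| + |X 2| := by
  refine le_of_sq_le_sq ?_ (by positivity)
  rw [EuclideanSpace.norm_sq_eq, Fin.sum_univ_three]
  simp only [Real.norm_eq_abs]
  nlinarith [mul_nonneg (abs_nonneg (X 0)) (abs_nonneg (X 1)),
    mul_nonneg (abs_nonneg (X 0)) (abs_nonneg (X 2)),
    mul_nonneg (abs_nonneg (X 1)) (abs_nonneg (X 2))]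

theorem RefInputs.Admissible.norm_signal_le {R : RefInputs} {M c : ℝ} (hR : R.Admissible M c)
    {t : ℝ} (ht : 0 ≤ t) : ‖R.signal t‖ ≤ M := by
  simp only [RefInputs.signal, Prod.norm_def, Real.norm_eq_abs, max_le_iff]
  exact ⟨hR.bound_v t ht, hR.bound_ω t ht, hR.bound_dv t ht, hR.bound_dω t ht⟩

namespace Params

/-- For large gains the decay rate is bounded below where `V ≥ ε²`. -/
theorem exists_SigAt_lower_bound {M c c₁ c₂ c₃ ε : ℝ} (hM : 0 ≤ M) (hc : 0 < c)
    (hc₁ : 0 < c₁) (hc₂ : 0 < c₂) (hc₃ : 0 < c₃) (hε : 0 < ε) :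
    ∃ γ₀ α : ℝ, 0 < γ₀ ∧ 0 < α ∧ ∀ P : Params, P.c₁ = c₁ → P.c₂ = c₂ → P.c₃ = c₃ → γ₀ ≤ P.γ →
      ∀ (X : ErrState) (q : Signal), c ≤ |q.1| → |q.2.1| ≤ M → ε ^ 2 ≤ P.VAt X q →
        α ≤ P.SigAt X q := by
  obtain ⟨b₀, hb₀, hsinc⟩ : ∃ b₀ > 0, ∀ θ : ℝ, |θ| < b₀ → 1 / 2 ≤ sinc θ := by
    have h := continuous_sinc.continuousAt.eventually (lt_mem_nhds (a := 1 / 2) (b := sinc 0)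
      (by rw [sinc_zero]; norm_num))
    obtain ⟨b, hb, h⟩ := Metric.eventually_nhds_iff.1 h
    exact ⟨b, hb, fun θ hθ => (h (by simpa using hθ)).le⟩
  -- For `|θ| < b`: `sinc θ ≥ 1/2`, the share of `θ` in `V` is at most `ε²/8` (as `γ ≥ 1`), and `c₂
  -- |θ| ≤ ε c / 4`.
  set b := min b₀ (min (ε / 2) (ε * c / (4 * c₂))) with hb
  have hbpos : 0 < b := by positivity
  -- One entry per case: `x₁` large, `θ` large, or both small. In the last case `|y| ≥ ε`, so `|ω̂|
  -- ≥ γ ε c / 2 - M - γ ε c / 4 ≥ ε c / 8` once `γ ≥ 1` and `8 M ≤ γ ε c`.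
  set α := min (c₁ * (ε ^ 2 / 2)) (min (c₂ * b ^ 2) (c₃ * (ε * c / 8) ^ 2 * ε ^ 2)) with hα
  refine ⟨1 + 8 * M / (ε * c), α, by positivity, by positivity, ?_⟩
  rintro P rfl rfl rfl hγ X q hq1 hq2 hV
  have hγ1 : 1 ≤ P.γ := le_trans (le_add_of_nonneg_right (by positivity)) hγ
  have hγM : 8 * M ≤ P.γ * (ε * c) := by
    have : 8 * M / (ε * c) ≤ P.γ := by linarith
    rwa [div_le_iff₀ (by positivity)] at this
  have hS1 : 0 ≤ P.c₁ * P.x₁At X q ^ 2 := by positivity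
  have hS2 : 0 ≤ P.c₂ * X 2 ^ 2 := by positivity
  have hS3 : 0 ≤ P.c₃ * P.omegaHatAt X q ^ 2 * X 1 ^ 2 := by positivity
  rw [SigAt]
  by_cases h1 : ε ^ 2 / 2 ≤ P.x₁At X q ^ 2
  · have := mul_le_mul_of_nonneg_left h1 hc₁.le
    linarith [min_le_left (P.c₁ * (ε ^ 2 / 2)) (min (P.c₂ * b ^ 2) (P.c₃ * (ε * c / 8) ^ 2 * ε ^ 2))]
  by_cases h2 : b ≤ |X 2|
  · have h3 : b ^ 2 ≤ X 2 ^ 2 := by rw [← sq_abs (X 2)]; gcongr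
    have := mul_le_mul_of_nonneg_left h3 hc₂.le
    have h4 : α ≤ P.c₂ * b ^ 2 := (min_le_right _ _).trans (min_le_left _ _)
    linarith
  push Not at h1 h2
  have hθ : X 2 ^ 2 ≤ (ε / 2) ^ 2 := by
    rw [← sq_abs (X 2)]
    have : |X 2| ≤ ε / 2 := h2.le.trans ((min_le_right _ _).trans (min_le_left _ _))
    gcongr
  have hθV : 1 / (2 * P.γ) * X 2 ^ 2 ≤ 1 / 2 * X 2 ^ 2 := by
    gcongr
    linarith
  have hy : ε ^ 2 ≤ X 1 ^ 2 := by
    rw [VAt] at hV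
    nlinarith
  have hy' : ε ≤ |X 1| := by
    rw [← abs_of_pos hε]; exact sq_le_sq.1 hy
  have hs : 1 / 2 ≤ sinc (X 2) := hsinc _ (h2.trans_le (min_le_left _ _))
  have hc2θ : P.c₂ * |X 2| ≤ ε * c / 4 := by
    have : |X 2| ≤ ε * c / (4 * P.c₂) := h2.le.trans ((min_le_right _ _).trans (min_le_right _ _))
    calc P.c₂ * |X 2| ≤ P.c₂ * (ε * c / (4 * P.c₂)) := by gcongr
      _ = ε * c / 4 := by field_simp
  have hprod : P.γ * (ε * c / 2) ≤ |P.γ * X 1 * q.1 * sinc (X 2)| := by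
    rw [abs_mul, abs_mul, abs_mul, abs_of_pos (by linarith : 0 < P.γ),
      abs_of_pos (by linarith : 0 < sinc (X 2))]
    calc P.γ * (ε * c / 2) = P.γ * ε * c * (1 / 2) := by ring
      _ ≤ P.γ * |X 1| * |q.1| * sinc (X 2) := by gcongr
  have hω : ε * c / 8 ≤ |P.omegaHatAt X q| := by
    have e : P.γ * X 1 * q.1 * sinc (X 2) = P.omegaHatAt X q - q.2.1 - P.γ * (P.c₂ * X 2) := by
      rw [omegaHatAt]; ring
    have : |P.γ * X 1 * q.1 * sinc (X 2)| ≤ |P.omegaHatAt X q| + |q.2.1| + P.γ * (P.c₂ * |X 2|) := by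
      rw [e]
      refine (abs_sub _ _).trans ?_
      rw [abs_mul P.γ, abs_mul P.c₂, abs_of_pos hc₂, abs_of_pos (by linarith : 0 < P.γ)]
      gcongr
      exact abs_sub _ _
    have h5 : P.γ * (P.c₂ * |X 2|) ≤ P.γ * (ε * c / 4) := by gcongr
    have h6 : 1 * (ε * c) ≤ P.γ * (ε * c) := by gcongr
    linarith
  have h7 : (ε * c / 8) ^ 2 ≤ P.omegaHatAt X q ^ 2 := by
    rw [← sq_abs (P.omegaHatAt X q)]; gcongr
  have h8 : P.c₃ * (ε * c / 8) ^ 2 * ε ^ 2 ≤ P.c₃ * P.omegaHatAt X q ^ 2 * X 1 ^ 2 := by gcongr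
  have h9 : α ≤ P.c₃ * (ε * c / 8) ^ 2 * ε ^ 2 := (min_le_right _ _).trans (min_le_right _ _)
  linarith

/-- Sublevel sets of `V` are bounded, uniformly in the reference values. -/
theorem exists_norm_le_of_VAt_le {P : Params} (hγ : 0 < P.γ) (M m : ℝ) :
    ∃ r : ℝ, 0 < r ∧ ∀ (X : ErrState) (q : Signal), ‖q‖ ≤ M → P.VAt X q ≤ m → ‖X‖ ≤ r := by
  set Y := √(2 * m)
  set Θ := √(2 * P.γ * m)
  -- `V` controls `x₁` instead of `x_e`; recovering `x_e` requires this bound on `omegaHat`.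
  set W := |M| + P.γ * Y * |M| + |P.c₂| * P.γ * Θ
  refine ⟨Y + |P.c₃| * W * Y + Y + Θ + 1, by positivity, fun X q hq hV => ?_⟩
  have hq1 : |q.1| ≤ |M| := (norm_fst_le q).trans (hq.trans (le_abs_self M))
  have hq2 : |q.2.1| ≤ |M| :=
    ((norm_fst_le q.2).trans (norm_snd_le q)).trans (hq.trans (le_abs_self M))
  rw [VAt] at hV
  have a1 := sq_nonneg (P.x₁At X q)
  have a2 := sq_nonneg (X 1)
  have a3 : 0 ≤ 1 / (2 * P.γ) * X 2 ^ 2 := by positivity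
  have hx : |P.x₁At X q| ≤ Y := abs_le_sqrt (by linarith)
  have hy : |X 1| ≤ Y := abs_le_sqrt (by linarith)
  have hθ : |X 2| ≤ Θ := by
    refine abs_le_sqrt ?_
    have : 1 / (2 * P.γ) * X 2 ^ 2 ≤ m := by linarith
    rw [div_mul_eq_mul_div, one_mul, div_le_iff₀ (by positivity)] at this
    linarith
  have hω : |P.omegaHatAt X q| ≤ W := by
    rw [omegaHatAt]
    refine (abs_add_three _ _ _).trans ?_
    simp only [abs_mul, abs_of_pos hγ]
    have : P.γ * |X 1| * |q.1| * |sinc (X 2)| ≤ P.γ * Y * |M| * 1 := by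
      gcongr
      exact abs_sinc_le_one _
    rw [mul_one] at this
    exact add_le_add (add_le_add hq2 this) (by gcongr)
  have h0 : |X 0| ≤ Y + |P.c₃| * W * Y := by
    have e : X 0 = P.x₁At X q + P.c₃ * P.omegaHatAt X q * X 1 := by rw [x₁At]; ring
    rw [e]
    refine (abs_add_le _ _).trans ?_
    rw [abs_mul, abs_mul]
    gcongr
  linarith [errState_norm_le X]

end Params

/-! ### A comparison principle. -/

/-- A function that decreases at rate at least `β` wherever it is at least `m`. -/
theorem le_max_of_decrease_above {f f' : ℝ → ℝ} {a b β m : ℝ} (hab : a ≤ b) (hβ : 0 ≤ β)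
    (hf : ∀ s ∈ Icc a b, HasDerivWithinAt f (f' s) (Icc a b) s)
    (hf' : ∀ s ∈ Ico a b, m ≤ f s → f' s ≤ -β) :
    f b ≤ max (f a - β * (b - a)) m := by
  by_contra! hcon
  obtain ⟨hcon1, hcon2⟩ := max_lt_iff.1 hcon
  have hcont : ContinuousOn f (Icc a b) := fun s hs => (hf s hs).continuousWithinAt
  -- To be applied with `d` the last time at which `f ≤ m`, where `f d = m`, or with `d = a` if
  -- there is none. From `d` on, the decay is in force, which contradicts the assumed size of `f b`.
  have key : ∀ d ∈ Icc a b, (∀ s ∈ Ico d b, d < s → m ≤ f s) → (d = a → m ≤ f a) →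
      (d ≠ a → f d = m) → f b ≤ f d - β * (b - d) := by
    intro d hd h1 h2 h3
    have hd' : ∀ s ∈ Ico d b, m ≤ f s := by
      intro s hs
      rcases hs.1.eq_or_lt with h | h
      · subst h
        by_cases hda : d = a
        · rw [hda]; exact h2 hda
        · exact (h3 hda).ge
      · exact h1 s hs h
    have hsub : Icc d b ⊆ Icc a b := Icc_subset_Icc_left hd.1
    refine image_le_of_deriv_right_le_deriv_boundary (B := fun s => f d - β * (s - d))
      (B' := fun _ => -β) (f' := f') (hcont.mono hsub) ?_ (by simp) (by fun_prop) ?_ ?_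
      (right_mem_Icc.2 hd.2)
    · intro x hx
      exact ((hf x (hsub (Ico_subset_Icc_self hx))).mono hsub).mono_of_mem_nhdsWithin
        (Icc_mem_nhdsGE_of_mem hx)
    · intro x _
      simpa using ((((hasDerivAt_id x).sub_const d).const_mul β).const_sub (f d)).hasDerivWithinAt
    · intro x hx
      exact hf' x ⟨hd.1.trans hx.1, hx.2⟩ (hd' x hx)
  by_cases hne : ({s | s ∈ Icc a b ∧ f s ≤ m}).Nonempty
  · have hcl : IsCompact {s | s ∈ Icc a b ∧ f s ≤ m} :=
      (isCompact_Icc (a := a) (b := b)).of_isClosed_subset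
        (hcont.preimage_isClosed_of_isClosed isClosed_Icc (isClosed_Iic (a := m)))
        fun s hs => hs.1
    obtain ⟨d, ⟨hd, hdm⟩, hmax⟩ := hcl.exists_isGreatest hne
    have hdb : d < b := hd.2.lt_of_ne (by rintro rfl; linarith)
    have hgt : ∀ s ∈ Ico d b, d < s → m ≤ f s := by
      intro s hs hds
      by_contra! h
      exact absurd (hmax ⟨⟨hd.1.trans hs.1, hs.2.le⟩, h.le⟩) (not_le.2 hds)
    have hdm' : f d = m := by
      refine le_antisymm hdm ?_
      have : ContinuousWithinAt f (Ioc d b) d :=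
        (hcont d hd).mono fun s hs => ⟨hd.1.trans hs.1.le, hs.2⟩
      have hne' : (𝓝[Ioc d b] d).NeBot := by
        rw [nhdsWithin_Ioc_eq_nhdsGT hdb]; infer_instance
      refine ge_of_tendsto this.tendsto ?_
      filter_upwards [self_mem_nhdsWithin] with s hs
      rcases hs.2.eq_or_lt with h | h
      · rw [h]; exact hcon2.le
      · exact hgt s ⟨hs.1.le, h⟩ hs.1
    have := key d hd hgt (fun h => by rw [← h, hdm']) (fun _ => hdm')
    nlinarith [mul_nonneg hβ (sub_nonneg.2 hdb.le)]
  · have hgt : ∀ s ∈ Icc a b, m ≤ f s := by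
      intro s hs
      by_contra! h
      exact hne ⟨s, hs, h.le⟩
    have := key a (left_mem_Icc.2 hab) (fun s hs _ => hgt s (Ico_subset_Icc_self hs))
      (fun _ => hgt a (left_mem_Icc.2 hab)) (fun h => absurd rfl h)
    linarith

/-! ### Constrained least-squares fit. -/

namespace Params

variable {P : Params}

theorem poly_zero_right (a : P.Coeffs) : P.poly a 0 = a 0 := by
  rw [poly, Fin.sum_univ_succ]
  simp

@[fun_prop]
theorem continuous_poly : Continuous fun z : P.Coeffs × ℝ => P.poly z.1 z.2 := by
  unfold poly
  fun_prop

theorem continuous_poly_right (a : P.Coeffs) : Continuous (P.poly a) := by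
  unfold poly
  fun_prop

theorem poly_smul (r : ℝ) (a : P.Coeffs) (τ : ℝ) : P.poly (r • a) τ = r * P.poly a τ := by
  simp only [poly, Pi.smul_apply, smul_eq_mul, Finset.mul_sum, mul_assoc]

theorem poly_single_zero (r τ : ℝ) : P.poly (Pi.single 0 r) τ = r := by
  rw [poly, Finset.sum_eq_single 0] <;> simp +contextual

theorem exists_poly_ne_zero (hT : 0 < P.T) {a : P.Coeffs} (ha : a ≠ 0) :
    ∃ τ ∈ Icc 0 P.T, P.poly a τ ≠ 0 := by
  by_contra! h
  let f : Polynomial ℝ := ∑ j : Fin (P.p + 1), Polynomial.monomial (j : ℕ) (a j)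
  have hf : f = 0 := by
    refine Polynomial.eq_zero_of_infinite_isRoot f ((Icc_infinite hT).mono fun τ hτ => ?_)
    simpa [f, Polynomial.IsRoot, Polynomial.eval_finsetSum, poly] using h τ hτ
  refine ha (funext fun i => ?_)
  have := congrArg (fun g => Polynomial.coeff g (i : ℕ)) hf
  simpa [f, Polynomial.finsetSum_coeff, Polynomial.coeff_monomial, Fin.val_inj] using this

/-- Equivalence of norms in finite dimension: `κ` is the minimum of the integral over the unit
sphere, and homogeneity does the rest. -/
theorem exists_norm_sq_le_integral_poly_sq (hT : 0 < P.T) :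
    ∃ κ : ℝ, 0 < κ ∧ ∀ a : P.Coeffs, κ * ‖a‖ ^ 2 ≤ ∫ τ in (0 : ℝ)..P.T, P.poly a τ ^ 2 := by
  have hcont : Continuous fun a : P.Coeffs => ∫ τ in (0 : ℝ)..P.T, P.poly a τ ^ 2 := by
    refine intervalIntegral.continuous_parametric_intervalIntegral_of_continuous' ?_ 0 P.T
    exact continuous_poly.pow 2
  obtain ⟨e, he, hmin⟩ := (isCompact_sphere (0 : P.Coeffs) 1).exists_isMinOn
    (NormedSpace.sphere_nonempty.2 zero_le_one) hcont.continuousOn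
  have he0 : e ≠ 0 := by
    rintro rfl
    simp at he
  obtain ⟨τ, hτ, hne⟩ := exists_poly_ne_zero hT he0
  have hpos : 0 < ∫ τ in (0 : ℝ)..P.T, P.poly e τ ^ 2 :=
    intervalIntegral.integral_pos hT ((continuous_poly_right e).pow 2).continuousOn
      (fun s _ => sq_nonneg _) ⟨τ, hτ, by positivity⟩
  refine ⟨_, hpos, fun a => ?_⟩
  by_cases ha : a = 0
  · subst ha
    simp [poly]
  have hn : ‖a‖ ≠ 0 := norm_ne_zero_iff.2 ha
  have h1 : ‖a‖⁻¹ • a ∈ Metric.sphere (0 : P.Coeffs) 1 := by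
    simp [norm_smul, hn]
  have h2 := hmin h1
  simp only [mem_ofPred_eq, poly_smul, mul_pow, intervalIntegral.integral_const_mul] at h2
  calc _ ≤ (‖a‖⁻¹ ^ 2 * ∫ τ in (0 : ℝ)..P.T, P.poly a τ ^ 2) * ‖a‖ ^ 2 := by gcongr
    _ = _ := by field_simp

variable {d : ℝ} {w w' : ℝ → ℝ}

theorem fitCost_congr (hT : 0 ≤ P.T) (h : EqOn w w' (Icc 0 P.T)) (a : P.Coeffs) :
    P.fitCost d w a = P.fitCost d w' a := by
  refine intervalIntegral.integral_congr fun τ hτ => ?_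
  rw [uIcc_of_le hT] at hτ
  simp only [h hτ]

theorem continuousOn_fit_integrand (hw : ContinuousOn w (Icc 0 P.T)) (a : P.Coeffs) :
    ContinuousOn (fun τ => |P.poly a τ - w τ| ^ 2 + d * |P.poly a τ| ^ 2) (Icc 0 P.T) := by
  have := (continuous_poly_right a).continuousOn (s := Icc 0 P.T)
  fun_prop

theorem continuous_fitCost (hT : 0 ≤ P.T) (hw : ContinuousOn w (Icc 0 P.T)) :
    Continuous (P.fitCost d w) := by
  have hw' : Continuous (IccExtend hT ((Icc 0 P.T).domRestrict w)) :=
    hw.domRestrict.Icc_extend'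
  have e : P.fitCost d w = P.fitCost d (IccExtend hT ((Icc 0 P.T).domRestrict w)) := by
    funext a
    exact fitCost_congr hT (fun τ hτ => (IccExtend_of_mem hT ((Icc 0 P.T).domRestrict w) hτ).symm) a
  rw [e]
  refine intervalIntegral.continuous_parametric_intervalIntegral_of_continuous' ?_ 0 P.T
  have := continuous_poly (P := P)
  simp only [Function.uncurry_def]
  fun_prop

/-- From `f² ≤ 2 (f - w)² + 2 w²`. This makes the cost coercive even when `d = 0`. -/
theorem integral_poly_sq_le (hT : 0 ≤ P.T) (hd : 0 ≤ d) (hw : ContinuousOn w (Icc 0 P.T))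
    (a : P.Coeffs) :
    ∫ τ in (0 : ℝ)..P.T, P.poly a τ ^ 2
      ≤ 2 * P.fitCost d w a + 2 * ∫ τ in (0 : ℝ)..P.T, w τ ^ 2 := by
  have i1 : IntervalIntegrable (fun τ => |P.poly a τ - w τ| ^ 2 + d * |P.poly a τ| ^ 2)
      MeasureTheory.volume 0 P.T := by
    refine ContinuousOn.intervalIntegrable ?_
    rw [uIcc_of_le hT]; exact continuousOn_fit_integrand hw a
  have i2 : IntervalIntegrable (fun τ => w τ ^ 2) MeasureTheory.volume 0 P.T := by
    refine ContinuousOn.intervalIntegrable ?_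
    rw [uIcc_of_le hT]; exact hw.pow 2
  rw [fitCost, ← intervalIntegral.integral_const_mul, ← intervalIntegral.integral_const_mul,
    ← intervalIntegral.integral_add (i1.const_mul 2) (i2.const_mul 2)]
  refine intervalIntegral.integral_mono_on hT
    (((continuous_poly_right a).pow 2).intervalIntegrable _ _)
    ((i1.const_mul 2).add (i2.const_mul 2)) fun τ _ => ?_
  simp only [sq_abs]
  nlinarith [sq_nonneg (P.poly a τ - 2 * w τ), mul_nonneg hd (sq_nonneg (P.poly a τ))]

/-- The constrained least-squares problem has a solution. -/
theorem exists_isBestFit (hT : 0 < P.T) (hd : 0 ≤ d) (hw : ContinuousOn w (Icc 0 P.T)) :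
    ∃ a : P.Coeffs, P.IsBestFit d w a := by
  obtain ⟨κ, hκ, hκa⟩ := exists_norm_sq_le_integral_poly_sq hT
  have hc := continuous_fitCost (d := d) hT.le hw
  -- The constant polynomial is feasible, so the search may be restricted to its sublevel set, which
  -- is compact.
  set b₀ : P.Coeffs := Pi.single 0 (w 0)
  set S : Set P.Coeffs := {b | b 0 = w 0 ∧ P.fitCost d w b ≤ P.fitCost d w b₀}
  have hb₀ : b₀ ∈ S := ⟨by simp [b₀], le_rfl⟩
  have hcl : IsClosed S :=
    (isClosed_eq (continuous_apply 0) continuous_const).inter (isClosed_le hc continuous_const)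
  have hbd : Bornology.IsBounded S := by
    refine isBounded_iff_forall_norm_le.2
      ⟨√((2 * P.fitCost d w b₀ + 2 * ∫ τ in (0 : ℝ)..P.T, w τ ^ 2) / κ), fun b hb => ?_⟩
    refine le_sqrt_of_sq_le ?_
    rw [le_div_iff₀ hκ, mul_comm]
    linarith [hκa b, integral_poly_sq_le hT.le hd hw b, hb.2]
  obtain ⟨a, ha, hmin⟩ := (Metric.isCompact_of_isClosed_isBounded hcl hbd).exists_isMinOn ⟨b₀, hb₀⟩
    hc.continuousOn
  refine ⟨a, by rw [poly_zero_right]; exact ha.1, fun b hb => ?_⟩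
  rw [poly_zero_right] at hb
  by_cases h : P.fitCost d w b ≤ P.fitCost d w b₀
  · exact hmin ⟨hb, h⟩
  · exact ha.2.trans (not_le.1 h).le

/-- The solutions of the constrained least-squares problem for bounded signals are bounded. -/
theorem exists_norm_le_of_isBestFit (hT : 0 < P.T) (hd : 0 ≤ d) (W : ℝ) :
    ∃ A : ℝ, ∀ w : ℝ → ℝ, ContinuousOn w (Icc 0 P.T) → (∀ τ ∈ Icc 0 P.T, |w τ| ≤ W) →
      ∀ a : P.Coeffs, P.IsBestFit d w a → ‖a‖ ≤ A := by
  obtain ⟨κ, hκ, hκa⟩ := exists_norm_sq_le_integral_poly_sq hT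
  -- The first term bounds the cost of the constant competitor `w 0`.
  refine ⟨√((2 * (P.T * ((2 * W) ^ 2 + d * W ^ 2)) + 2 * (P.T * W ^ 2)) / κ),
    fun w hw hW a ha => ?_⟩
  refine le_sqrt_of_sq_le ?_
  rw [le_div_iff₀ hκ, mul_comm]
  have h0 : (0 : ℝ) ∈ Icc 0 P.T := left_mem_Icc.2 hT.le
  have h1 : P.fitCost d w a ≤ P.fitCost d w (Pi.single 0 (w 0)) :=
    ha.2 _ (poly_single_zero _ _)
  have h2 : P.fitCost d w (Pi.single 0 (w 0)) ≤ P.T * ((2 * W) ^ 2 + d * W ^ 2) := by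
    have : P.T * ((2 * W) ^ 2 + d * W ^ 2)
        = ∫ _ in (0 : ℝ)..P.T, ((2 * W) ^ 2 + d * W ^ 2) := by
      rw [intervalIntegral.integral_const]; simp
    rw [this, fitCost]
    refine intervalIntegral.integral_mono_on hT.le ?_ (by simp) fun τ hτ => ?_
    · refine ContinuousOn.intervalIntegrable ?_
      rw [uIcc_of_le hT.le]; exact continuousOn_fit_integrand hw _
    · rw [poly_single_zero]
      have : |w 0 - w τ| ≤ 2 * W := (abs_sub _ _).trans (by linarith [hW 0 h0, hW τ hτ])
      have := hW 0 h0
      gcongr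
  have h3 : ∫ τ in (0 : ℝ)..P.T, w τ ^ 2 ≤ P.T * W ^ 2 := by
    have : P.T * W ^ 2 = ∫ _ in (0 : ℝ)..P.T, W ^ 2 := by simp
    rw [this]
    refine intervalIntegral.integral_mono_on hT.le ?_ (by simp) fun τ hτ => ?_
    · refine ContinuousOn.intervalIntegrable ?_
      rw [uIcc_of_le hT.le]; exact hw.pow 2
    · rw [← sq_abs]
      have := hW τ hτ
      gcongr
  linarith [hκa a, integral_poly_sq_le hT.le hd hw a]

/-- The interval is `[0, 1]`, unrelated to `T`: the next event may come after the fitting horizon.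
-/
theorem abs_poly_le (a : P.Coeffs) {τ : ℝ} (hτ : τ ∈ Icc (0 : ℝ) 1) :
    |P.poly a τ| ≤ (P.p + 1) * ‖a‖ := by
  have : ∀ j ∈ Finset.univ, |a j * τ ^ (j : ℕ)| ≤ ‖a‖ := by
    intro j _
    rw [abs_mul, abs_pow, abs_of_nonneg hτ.1]
    calc |a j| * τ ^ (j : ℕ) ≤ ‖a‖ * 1 := by
          gcongr
          · exact pow_nonneg hτ.1 _
          · exact norm_le_pi_norm a j
          · exact pow_le_one₀ hτ.1 hτ.2
      _ = ‖a‖ := mul_one _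
  refine (Finset.abs_sum_le_sum_abs _ _).trans ((Finset.sum_le_card_nsmul _ _ _ this).trans ?_)
  simp

theorem abs_poly_sub_le (a : P.Coeffs) {τ : ℝ} (hτ : τ ∈ Icc (0 : ℝ) 1) :
    |P.poly a τ - P.poly a 0| ≤ (P.p + 1) * ‖a‖ * τ := by
  have : ∀ j ∈ Finset.univ, |a j * τ ^ (j : ℕ) - a j * 0 ^ (j : ℕ)| ≤ ‖a‖ * τ := by
    intro j _
    rcases Nat.eq_zero_or_pos (j : ℕ) with h | h
    · simpa [h] using mul_nonneg (norm_nonneg a) hτ.1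
    · rw [zero_pow h.ne', mul_zero, sub_zero, abs_mul, abs_pow, abs_of_nonneg hτ.1]
      gcongr
      · exact pow_nonneg hτ.1 _
      · exact norm_le_pi_norm a j
      · exact pow_le_of_le_one hτ.1 hτ.2 h.ne'
  rw [poly, poly, ← Finset.sum_sub_distrib]
  refine (Finset.abs_sum_le_sum_abs _ _).trans ((Finset.sum_le_card_nsmul _ _ _ this).trans ?_)
  simp [mul_assoc]

end Params

/-! ### Uniform estimates under the standing assumptions. -/

theorem RefInputs.Admissible.uniformContinuousOn_signal {R : RefInputs} {M c : ℝ}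
    (hR : R.Admissible M c) (hv : UniformContinuousOn R.dv (Ici 0))
    (hω : UniformContinuousOn R.dω (Ici 0)) : UniformContinuousOn R.signal (Ici 0) := by
  have lip : ∀ f : ℝ → ℝ, DifferentiableOn ℝ f (Ici 0) →
      (∀ t, 0 ≤ t → |derivWithin f (Ici 0) t| ≤ M) → UniformContinuousOn f (Ici 0) := by
    intro f hf hb
    refine ((convex_Ici (0 : ℝ)).lipschitzOnWith_of_nnnorm_derivWithin_le (C := M.toNNReal) hf
      fun t ht => ?_).uniformContinuousOn
    rw [← NNReal.coe_le_coe, coe_nnnorm, Real.norm_eq_abs]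
    exact (hb t ht).trans (le_coe_toNNReal M)
  have h₁ := lip _ hR.diff_v hR.bound_dv
  have h₂ := lip _ hR.diff_ω hR.bound_dω
  rw [uniformContinuousOn_iff_restrict] at hv hω h₁ h₂ ⊢
  exact h₁.prodMk (h₂.prodMk (hv.prodMk hω))

/-- The standing assumptions on the parameters and on the reference inputs; `α` is a lower bound
of the decay rate where `V ≥ ε²`. -/
structure Standing (P : Params) (R : RefInputs) (M c α : ℝ) : Prop where
  γ_pos : 0 < P.γ
  σ_pos : 0 < P.σ
  σ_lt : P.σ < 1
  T_pos : 0 < P.T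
  δ_nonneg : ∀ i, 0 ≤ P.δ i
  adm : R.Admissible M c
  cont_signal : UniformContinuousOn R.signal (Ici 0)
  α_pos : 0 < α
  le_Sig : ∀ (X : ErrState) (t : ℝ), 0 ≤ t → P.ε ^ 2 ≤ P.V R X t → α ≤ P.Sig R X t
  Sig_nonneg : ∀ (X : ErrState) (t : ℝ), 0 ≤ P.Sig R X t

namespace Standing

variable {P : Params} {R : RefInputs} {M c α : ℝ}

theorem Vdot_uHat (H : Standing P R M c α) (X : ErrState) {t : ℝ} (ht : 0 ≤ t) :
    P.Vdot R X (P.uHat R X t) t = -P.Sig R X t := by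
  rw [Params.Vdot_eq H.adm H.γ_pos.ne' _ ht, Params.uHat_eq, Params.VdotAt_uHatAt _ _ H.γ_pos.ne',
    Params.Sig_eq]

theorem hasDerivWithinAt_V (H : Standing P R M c α) {Y : ℝ → ErrState} {u : Fin 2 → ℝ}
    {S : Set ℝ} {s : ℝ} (hY : HasDerivWithinAt Y (errField R (Y s) u s) S s) (hS : S ⊆ Ici 0)
    (hs : 0 ≤ s) : HasDerivWithinAt (fun r => P.V R (Y r) r) (P.Vdot R (Y s) u s) S s := by
  rw [Params.Vdot_eq H.adm H.γ_pos.ne' _ hs, Params.VdotAt, ← errField_eq]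
  exact Params.hasDerivWithinAt_V_curve H.adm H.γ_pos.ne' hY hS hs

/-- `V` does not increase under the continuous-time controller. -/
theorem V_le_of_uHat (H : Standing P R M c α) {Y : ℝ → ErrState} {a b : ℝ} (ha : 0 ≤ a)
    (hY : ∀ s ∈ Icc a b,
      HasDerivWithinAt Y (errField R (Y s) (P.uHat R (Y s) s) s) (Icc a b) s) :
    ∀ s ∈ Icc a b, P.V R (Y s) s ≤ P.V R (Y a) a := by
  intro s hs
  have hsub : Icc a s ⊆ Icc a b := Icc_subset_Icc_right hs.2
  have h0 : Icc a s ⊆ Ici 0 := fun r hr => ha.trans hr.1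
  have := le_max_of_decrease_above (f := fun r => P.V R (Y r) r) (m := P.V R (Y a) a) hs.1 le_rfl
    (fun r hr => H.hasDerivWithinAt_V ((hY r (hsub hr)).mono hsub) h0 (h0 hr))
    (fun r hr _ => by
      rw [H.Vdot_uHat _ (h0 (Ico_subset_Icc_self hr)), neg_zero, neg_nonpos]
      exact H.Sig_nonneg _ _)
  simpa using this

/-- `uHat` involves `dv` and `dω` through `v₂`, so a modulus uniform in time relies on their uniform
continuity. -/
theorem exists_modulus_uHat (H : Standing P R M c α) (r : ℝ) {η : ℝ} (hη : 0 < η) :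
    ∃ d : ℝ, 0 < d ∧ ∀ (X Y : ErrState) (s t : ℝ), ‖X‖ ≤ r → ‖Y‖ ≤ r → 0 ≤ s → 0 ≤ t →
      dist X Y < d → dist s t < d → dist (P.uHat R X s) (P.uHat R Y t) < η := by
  have hK : IsCompact (Metric.closedBall (0 : ErrState) r ×ˢ Metric.closedBall (0 : Signal) M) :=
    (isCompact_closedBall _ _).prod (isCompact_closedBall _ _)
  obtain ⟨d₁, hd₁, h₁⟩ := Metric.uniformContinuousOn_iff.1 (hK.uniformContinuousOn_of_continuous
    (Params.contDiff_uHatAt (P := P) (n := 0)).continuous.continuousOn) η hη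
  obtain ⟨d₂, hd₂, h₂⟩ := Metric.uniformContinuousOn_iff.1 H.cont_signal d₁ hd₁
  refine ⟨min d₁ d₂, lt_min hd₁ hd₂, fun X Y s t hX hY hs ht hXY hst => ?_⟩
  refine h₁ (X, R.signal s) ⟨by simpa using hX, by simpa using H.adm.norm_signal_le hs⟩
    (Y, R.signal t) ⟨by simpa using hY, by simpa using H.adm.norm_signal_le ht⟩ ?_
  rw [Prod.dist_eq]
  exact max_lt (hXY.trans_le (min_le_left _ _))
    (h₂ s hs t ht (hst.trans_le (min_le_right _ _)))

theorem exists_V_le (H : Standing P R M c α) (ρ : ℝ) :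
    ∃ m : ℝ, ∀ (X : ErrState) (t : ℝ), 0 ≤ t → ‖X‖ ≤ ρ → P.V R X t ≤ m := by
  have hK : IsCompact (Metric.closedBall (0 : ErrState) ρ ×ˢ Metric.closedBall (0 : Signal) M) :=
    (isCompact_closedBall _ _).prod (isCompact_closedBall _ _)
  obtain ⟨m, hm⟩ := hK.bddAbove_image (Params.continuous_VAt (P := P)).continuousOn
  refine ⟨m, fun X t ht hX => hm ⟨(X, R.signal t), ⟨by simpa using hX, ?_⟩, rfl⟩⟩
  simpa using H.adm.norm_signal_le ht

theorem exists_norm_le (H : Standing P R M c α) (m : ℝ) :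
    ∃ r : ℝ, 0 < r ∧ ∀ (X : ErrState) (t : ℝ), 0 ≤ t → P.V R X t ≤ m → ‖X‖ ≤ r := by
  obtain ⟨r, hr, h⟩ := Params.exists_norm_le_of_VAt_le H.γ_pos M m
  exact ⟨r, hr, fun X t ht hV => h X _ (H.adm.norm_signal_le ht) hV⟩

theorem continuousOn_uHat_curve (H : Standing P R M c α) {Y : ℝ → ErrState} {S : Set ℝ}
    (hY : ContinuousOn Y S) (hS : S ⊆ Ici 0) :
    ContinuousOn (fun s => P.uHat R (Y s) s) S :=
  (Params.contDiff_uHatAt (P := P) (n := 0)).continuous.comp_continuousOn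
    (hY.prodMk (H.cont_signal.continuousOn.mono hS))

theorem continuousOn_uHat_shift (H : Standing P R M c α) {Y : ℝ → ErrState} {t : ℝ} (ht : 0 ≤ t)
    (hY : ContinuousOn Y (Icc t (t + P.T))) (i : Fin 2) :
    ContinuousOn (fun τ => P.uHat R (Y (t + τ)) (t + τ) i) (Icc 0 P.T) := by
  have h := H.continuousOn_uHat_curve hY fun s hs => ht.trans hs.1
  refine (continuous_apply i).comp_continuousOn (h.comp (by fun_prop) fun τ hτ => ?_)
  exact ⟨by linarith [hτ.1], by linarith [hτ.2]⟩

end Standing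

/-! ### Decay of `V` along closed-loop trajectories. -/

namespace ClosedLoop

variable {P : Params} {R : RefInputs} {M c α t₀ : ℝ} (S : ClosedLoop P R t₀) {k : ℕ}

theorem t_lt_t_succ (hk : (k : ℕ∞) < S.N) : S.t k < S.t (k + 1) :=
  (S.next_event k hk).1.2.1

theorem left_mem_arc (_ : (k : ℕ∞) ≤ S.N) : S.t k ∈ arc S.N S.t k :=
  ⟨le_rfl, fun h => (S.t_lt_t_succ h).le⟩

theorem t₀_le_t (hk : (k : ℕ∞) ≤ S.N) : t₀ ≤ S.t k := by
  induction k with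
  | zero => exact S.t_zero.ge
  | succ k ih =>
    have h : (k : ℕ∞) < S.N := lt_of_lt_of_le (by exact_mod_cast k.lt_succ_self) hk
    exact (ih h.le).trans (S.t_lt_t_succ h).le

theorem not_trigger (hk : (k : ℕ∞) ≤ S.N) {s : ℝ} (h1 : S.t k < s)
    (h2 : (k : ℕ∞) < S.N → s < S.t (k + 1)) :
    ¬ P.Trigger R (S.X s) (fun i => P.poly (S.a k i) (s - S.t k)) s := by
  rcases hk.lt_or_eq with h | h
  · intro hT
    exact absurd ((S.next_event k h).2 ⟨⟨h1.le, fun _ => (h2 h).le⟩, h1, hT⟩) (not_le.2 (h2 h))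
  · exact S.last_event k h s h1

theorem poly_zero_eq_uHat (hk : (k : ℕ∞) ≤ S.N) :
    (fun i => P.poly (S.a k i) 0) = P.uHat R (S.X (S.t k)) (S.t k) := by
  funext i
  have := (S.a_fit k hk i).1
  simpa [S.Xhat_init k hk] using this

theorem V_le_arc (H : Standing P R M c α) (ht₀ : 0 ≤ t₀) (hk : (k : ℕ∞) ≤ S.N) {s : ℝ}
    (hs : s ∈ arc S.N S.t k) :
    P.V R (S.X s) s
      ≤ max (P.V R (S.X (S.t k)) (S.t k) - P.σ * α * (s - S.t k)) (P.ε ^ 2) := by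
  have h0 : Icc (S.t k) s ⊆ Ici 0 := fun r hr => (ht₀.trans (S.t₀_le_t hk)).trans hr.1
  have hsub : Icc (S.t k) s ⊆ arc S.N S.t k := fun r hr => ⟨hr.1, fun h => hr.2.trans (hs.2 h)⟩
  refine le_max_of_decrease_above (f := fun r => P.V R (S.X r) r) hs.1
    (mul_pos H.σ_pos H.α_pos).le
    (fun r hr => H.hasDerivWithinAt_V ((S.X_ode k hk r (hsub hr)).mono hsub) h0 (h0 hr)) ?_
  intro r hr hV
  have hr0 := h0 (Ico_subset_Icc_self hr)
  have hα := H.le_Sig _ _ hr0 hV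
  rcases hr.1.eq_or_lt with h | h
  · subst h
    -- Minimality of the next event says nothing about `t_k` itself; there the input is exactly
    -- `uHat`.
    simp only [sub_self, S.poly_zero_eq_uHat hk, H.Vdot_uHat _ hr0]
    nlinarith [H.σ_lt, H.α_pos]
  · have hT := S.not_trigger hk h fun h' => hr.2.trans_le (hs.2 h')
    have : P.Vdot R (S.X r) (fun i => P.poly (S.a k i) (r - S.t k)) r < -P.σ * P.Sig R (S.X r) r := by
      by_contra! hcon
      exact hT ⟨hcon, hV⟩
    have := mul_le_mul_of_nonneg_left hα H.σ_pos.le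
    linarith

theorem V_le_event (H : Standing P R M c α) (ht₀ : 0 ≤ t₀) (hk : (k : ℕ∞) ≤ S.N) :
    P.V R (S.X (S.t k)) (S.t k)
      ≤ max (P.V R (S.X t₀) t₀ - P.σ * α * (S.t k - t₀)) (P.ε ^ 2) := by
  induction k with
  | zero => simp [S.t_zero]
  | succ k ih =>
    have h : (k : ℕ∞) < S.N := lt_of_lt_of_le (by exact_mod_cast k.lt_succ_self) hk
    have hlt := S.t_lt_t_succ h
    refine (S.V_le_arc H ht₀ h.le (s := S.t (k + 1)) ⟨hlt.le, fun _ => le_rfl⟩).trans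
      (max_le ?_ (le_max_right _ _))
    have hσα := mul_pos H.σ_pos H.α_pos
    rcases le_max_iff.1 (ih h.le) with h1 | h1
    · exact le_max_of_le_left (by linarith)
    · refine le_max_of_le_right ?_
      nlinarith

theorem V_le (H : Standing P R M c α) (ht₀ : 0 ≤ t₀) (hk : (k : ℕ∞) ≤ S.N) {s : ℝ}
    (hs : s ∈ arc S.N S.t k) :
    P.V R (S.X s) s ≤ max (P.V R (S.X t₀) t₀ - P.σ * α * (s - t₀)) (P.ε ^ 2) := by
  refine (S.V_le_arc H ht₀ hk hs).trans (max_le ?_ (le_max_right _ _))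
  have hσα := mul_pos H.σ_pos H.α_pos
  have hlt := hs.1
  rcases le_max_iff.1 (S.V_le_event H ht₀ hk) with h1 | h1
  · exact le_max_of_le_left (by linarith)
  · refine le_max_of_le_right ?_
    nlinarith

end ClosedLoop

/-! ### Lower bound on inter-event times. -/

/-- A lower bound on the inter-event times in terms of the value of `V` at the event. -/
theorem Standing.exists_gap {P : Params} {R : RefInputs} {M c α : ℝ} (H : Standing P R M c α)
    (m : ℝ) :
    ∃ τ : ℝ, 0 < τ ∧ ∀ t₀ : ℝ, 0 ≤ t₀ → ∀ (S : ClosedLoop P R t₀) (k : ℕ), (k : ℕ∞) < S.N →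
      P.V R (S.X (S.t k)) (S.t k) ≤ m → τ ≤ S.t (k + 1) - S.t k := by
  obtain ⟨r, hr, hnorm⟩ := H.exists_norm_le (max m (P.ε ^ 2))
  have hK₁ : IsCompact (Metric.closedBall (0 : ErrState) r ×ˢ Metric.closedBall (0 : Signal) M) :=
    (isCompact_closedBall _ _).prod (isCompact_closedBall _ _)
  obtain ⟨W, hW⟩ := hK₁.exists_bound_of_continuousOn
    (Params.contDiff_uHatAt (P := P) (n := 0)).continuous.continuousOn
  have hW' : ∀ (X : ErrState) (t : ℝ), 0 ≤ t → ‖X‖ ≤ r → ‖P.uHat R X t‖ ≤ W := fun X t ht hX =>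
    hW (X, R.signal t) ⟨by simpa using hX, by simpa using H.adm.norm_signal_le ht⟩
  choose A hA using fun i => Params.exists_norm_le_of_isBestFit H.T_pos (H.δ_nonneg i) W
  set B := max 0 (max (A 0) (A 1)) with hB
  have hB0 : 0 ≤ B := le_max_left _ _
  have hAB : ∀ i, A i ≤ B := by
    intro i
    fin_cases i
    · exact (le_max_left _ _).trans (le_max_right _ _)
    · exact (le_max_right _ _).trans (le_max_right _ _)
  set U := ((P.p : ℝ) + 1) * B with hU
  have hU0 : 0 ≤ U := by positivity
  have hK₂ : IsCompact (Metric.closedBall (0 : ErrState) r ×ˢ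
      Metric.closedBall (0 : Fin 2 → ℝ) (max U W) ×ˢ Metric.closedBall (0 : Signal) M) :=
    (isCompact_closedBall _ _).prod ((isCompact_closedBall _ _).prod (isCompact_closedBall _ _))
  obtain ⟨C, hC⟩ := hK₂.exists_bound_of_continuousOn
    (Params.contDiff_fieldAt (n := 0)).continuous.continuousOn
  have hσα : 0 < (1 - P.σ) * α := mul_pos (by linarith [H.σ_lt]) H.α_pos
  obtain ⟨η, hη, hVdot⟩ := Metric.uniformContinuousOn_iff.1
    (hK₂.uniformContinuousOn_of_continuous (Params.continuous_VdotAt (P := P)).continuousOn) _ hσα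
  obtain ⟨d, hd, hmod⟩ := H.exists_modulus_uHat r (half_pos hη)
  -- In order: `1` validates the polynomial bounds, `d` limits the drift of the references, `d /
  -- (|C| + 1)` keeps the state within `d`, and the last entry keeps the polynomial input within `η
  -- / 2` of its initial value.
  refine ⟨min 1 (min d (min (d / (|C| + 1)) (η / 2 / (U + 1)))), by positivity, ?_⟩
  intro t₀ ht₀ S k hk hV
  by_contra! hlt
  simp only [lt_min_iff] at hlt
  obtain ⟨h1, h2, h3, h4⟩ := hlt
  rw [lt_div_iff₀ (by positivity)] at h3 h4
  have htk : 0 ≤ S.t k := ht₀.trans (S.t₀_le_t hk.le)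
  have hstep := S.t_lt_t_succ hk
  have harc : arc S.N S.t k = Icc (S.t k) (S.t (k + 1)) := by
    ext s
    simp [arc, hk]
  have hσα' := mul_pos H.σ_pos H.α_pos
  have hXr : ∀ s ∈ Icc (S.t k) (S.t (k + 1)), ‖S.X s‖ ≤ r := by
    intro s hs
    refine hnorm _ s (htk.trans hs.1) ?_
    refine (S.V_le_arc H ht₀ hk.le (harc ▸ hs)).trans (max_le_max ?_ le_rfl)
    have := mul_nonneg hσα'.le (sub_nonneg.2 hs.1)
    linarith
  have hhat : ∀ s ∈ Icc (S.t k) (S.t k + P.T), ‖S.Xhat k s‖ ≤ r := by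
    intro s hs
    refine hnorm _ s (htk.trans hs.1) ?_
    refine (H.V_le_of_uHat htk (S.Xhat_ode k hk.le) s hs).trans ?_
    rw [S.Xhat_init k hk.le]
    exact hV.trans (le_max_left _ _)
  have hcoef : ∀ i, ‖S.a k i‖ ≤ B := by
    intro i
    refine (hA i _ (H.continuousOn_uHat_shift htk
      (fun s hs => (S.Xhat_ode k hk.le s hs).continuousWithinAt) i) ?_ _ (S.a_fit k hk.le i)).trans
      (hAB i)
    intro τ hτ
    exact (norm_le_pi_norm _ i).trans (hW' _ _ (by linarith [hτ.1])
      (hhat _ ⟨by linarith [hτ.1], by linarith [hτ.2]⟩))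
  have hτ : ∀ s ∈ Icc (S.t k) (S.t (k + 1)), s - S.t k ∈ Icc (0 : ℝ) 1 :=
    fun s hs => ⟨by linarith [hs.1], by linarith [hs.2]⟩
  have hu : ∀ s ∈ Icc (S.t k) (S.t (k + 1)), ‖fun i => P.poly (S.a k i) (s - S.t k)‖ ≤ max U W := by
    intro s hs
    refine (pi_norm_le_iff_of_nonneg (hU0.trans (le_max_left _ _))).2 fun i => ?_
    refine (Params.abs_poly_le _ (hτ s hs)).trans (le_max_of_le_left ?_)
    exact mul_le_mul_of_nonneg_left (hcoef i) (by positivity)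
  have hright := right_mem_Icc.2 hstep.le
  have hleft := left_mem_Icc.2 hstep.le
  have hXX : ‖S.X (S.t (k + 1)) - S.X (S.t k)‖ ≤ C * (S.t (k + 1) - S.t k) := by
    refine norm_image_sub_le_of_norm_deriv_le_segment'
      (fun s hs => harc ▸ S.X_ode k hk.le s (harc ▸ hs)) (fun s hs => ?_) _ hright
    have hs' := Ico_subset_Icc_self hs
    rw [errField_eq]
    exact hC (S.X s, _, R.signal s) ⟨by simpa using hXr s hs',
      mem_closedBall_zero_iff.2 (hu s hs'),
      by simpa using H.adm.norm_signal_le (htk.trans hs.1)⟩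
  set s := S.t (k + 1) with hs
  have hs0 : 0 ≤ s := htk.trans hstep.le
  set u : Fin 2 → ℝ := fun i => P.poly (S.a k i) (s - S.t k) with hudef
  have hdist : dist u (P.uHat R (S.X s) s) < η := by
    have e1 : dist u (P.uHat R (S.X (S.t k)) (S.t k)) ≤ η / 2 := by
      rw [← S.poly_zero_eq_uHat hk.le, dist_pi_le_iff (by positivity)]
      intro i
      rw [Real.dist_eq]
      refine (Params.abs_poly_sub_le _ (hτ s hright)).trans ?_
      have : ((P.p : ℝ) + 1) * ‖S.a k i‖ ≤ U := mul_le_mul_of_nonneg_left (hcoef i) (by positivity)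
      have := mul_le_mul_of_nonneg_right this (sub_nonneg.2 hstep.le)
      linarith
    have e2 : dist (P.uHat R (S.X (S.t k)) (S.t k)) (P.uHat R (S.X s) s) < η / 2 := by
      refine hmod _ _ _ _ (hXr _ hleft) (hXr _ hright) htk hs0 ?_ ?_
      · rw [dist_comm, dist_eq_norm]
        have := mul_le_mul_of_nonneg_right (le_abs_self C) (sub_nonneg.2 hstep.le)
        linarith
      · rw [dist_comm, Real.dist_eq, abs_of_pos (sub_pos.2 hstep)]
        exact h2
    linarith [dist_triangle u (P.uHat R (S.X (S.t k)) (S.t k)) (P.uHat R (S.X s) s)]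
  -- At the event `Vdot ≥ -σ Σ`, while `uHat` gives `-Σ`. The two differ by at least `(1 - σ) α`,
  -- although the inputs are `η`-close.
  obtain ⟨hT1, hT2⟩ := (S.next_event k hk).1.2.2
  have hball : ∀ w : Fin 2 → ℝ, ‖w‖ ≤ max U W → (S.X s, w, R.signal s) ∈
      Metric.closedBall (0 : ErrState) r ×ˢ
      Metric.closedBall (0 : Fin 2 → ℝ) (max U W) ×ˢ Metric.closedBall (0 : Signal) M :=
    fun w hw => ⟨by simpa using hXr _ hright, by simpa using hw,
      by simpa using H.adm.norm_signal_le hs0⟩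
  have hV' := hVdot _ (hball u (hu s hright)) _
    (hball (P.uHat R (S.X s) s) ((hW' _ _ hs0 (hXr _ hright)).trans (le_max_right _ _)))
    (by simpa [Prod.dist_eq, hη] using hdist)
  simp only at hV'
  rw [← Params.Vdot_eq H.adm H.γ_pos.ne' _ hs0, ← Params.Vdot_eq H.adm H.γ_pos.ne' _ hs0,
    H.Vdot_uHat _ hs0, Real.dist_eq] at hV'
  have hα := H.le_Sig _ _ hs0 hT2
  have := (abs_lt.1 hV').2
  have hm := mul_le_mul_of_nonneg_left hα (by linarith [H.σ_lt] : (0 : ℝ) ≤ 1 - P.σ)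
  linarith

/-! ### Existence of trajectories. -/

namespace Standing

variable {P : Params} {R : RefInputs} {M c α : ℝ}

/-- The continuous-time closed loop has solutions on `[t, t + T]`. -/
theorem exists_uHat_solution (H : Standing P R M c α) {t : ℝ} (ht : 0 ≤ t) (X₀ : ErrState) :
    ∃ Y : ℝ → ErrState, Y t = X₀ ∧ ∀ s ∈ Icc t (t + P.T),
      HasDerivWithinAt Y (errField R (Y s) (P.uHat R (Y s) s) s) (Icc t (t + P.T)) s := by
  have hT := H.T_pos
  obtain ⟨r, hr, hnorm⟩ := H.exists_norm_le (P.V R X₀ t)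
  -- The cutoff makes the field bounded, so Picard–Lindelöf reaches all of `[t, t + T]`. It is
  -- inactive on the solution, because `V` does not increase while the norm is at most `r + 1`.
  let χ : ContDiffBump (0 : ErrState) := ⟨r + 1, r + 2, by linarith, by linarith⟩
  let g : ErrState × Signal → ErrState := fun z => χ z.1 • fieldAt z.1 (P.uHatAt z.1 z.2) z.2
  have hg : ContDiff ℝ 1 g := by
    refine (χ.contDiff.comp contDiff_fst).smul ?_
    exact Params.contDiff_fieldAt.comp
      (contDiff_fst.prodMk (Params.contDiff_uHatAt.prodMk contDiff_snd))
  have hK : ∀ (x : ErrState) (b : ℝ),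
      IsCompact (Metric.closedBall x b ×ˢ Metric.closedBall (0 : Signal) M) :=
    fun x b => (isCompact_closedBall _ _).prod (isCompact_closedBall _ _)
  obtain ⟨L, hL⟩ := (hK 0 (r + 2)).exists_bound_of_continuousOn hg.continuous.continuousOn
  have hsig : ∀ s ∈ Icc t (t + P.T), R.signal s ∈ Metric.closedBall (0 : Signal) M :=
    fun s hs => by simpa using H.adm.norm_signal_le (ht.trans hs.1)
  have hL' : ∀ s ∈ Icc t (t + P.T), ∀ X, ‖g (X, R.signal s)‖ ≤ L.toNNReal := by
    intro s hs X
    by_cases hX : ‖X‖ ≤ r + 2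
    · exact (hL (X, R.signal s) ⟨by simpa using hX, hsig s hs⟩).trans (le_coe_toNNReal L)
    · have : χ X = 0 := χ.zero_of_le_dist (by simpa [χ] using (not_le.1 hX).le)
      simp [g, this]
  set b : NNReal := L.toNNReal * P.T.toNNReal with hb
  obtain ⟨K, hKlip⟩ := (hg.locallyLipschitz.locallyLipschitzOn
    (s := Metric.closedBall X₀ b ×ˢ Metric.closedBall (0 : Signal) M)).exists_lipschitzOnWith_of_compact
      (hK X₀ b)
  have htmem : t ∈ Icc t (t + P.T) := ⟨le_rfl, by linarith⟩
  have hPL : IsPicardLindelof (fun s X => g (X, R.signal s)) (⟨t, htmem⟩ : Icc t (t + P.T)) X₀ b 0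
      L.toNNReal K :=
    { lipschitzOnWith := fun s hs X hX Y hY => by
        simpa [Prod.edist_eq] using hKlip (x := (X, R.signal s)) ⟨hX, hsig s hs⟩
          (y := (Y, R.signal s)) ⟨hY, hsig s hs⟩
      continuousOn := fun X _ => hg.continuous.comp_continuousOn
        (continuousOn_const.prodMk (H.cont_signal.continuousOn.mono fun s hs => ht.trans hs.1))
      norm_le := fun s hs X _ => hL' s hs X
      mul_max_le := by simp [hb, hT.le] }
  obtain ⟨Y, hY0, hY⟩ := hPL.exists_eq_forall_mem_Icc_hasDerivWithinAt₀
  simp only at hY0 hY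
  have hYc : ContinuousOn Y (Icc t (t + P.T)) := fun s hs => (hY s hs).continuousWithinAt
  have hfield : ∀ s, ‖Y s‖ ≤ r + 1 → g (Y s, R.signal s) = errField R (Y s) (P.uHat R (Y s) s) s := by
    intro s hs
    have : χ (Y s) = 1 := χ.one_of_mem_closedBall (by simpa [χ] using hs)
    simp only [g, this, one_smul, errField_eq, Params.uHat_eq]
  have hbound : ∀ s ∈ Icc t (t + P.T), ‖Y s‖ < r + 1 := by
    by_contra! hcon
    -- At the first time the norm reaches `r + 1`, continuity and the decay of `V` before it still
    -- give norm at most `r`.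
    obtain ⟨s₁, ⟨hs₁, hYs₁⟩, hmin⟩ := IsCompact.exists_isLeast
      (s := {s | s ∈ Icc t (t + P.T) ∧ r + 1 ≤ ‖Y s‖})
      ((isCompact_Icc (a := t) (b := t + P.T)).of_isClosed_subset
        (hYc.norm.preimage_isClosed_of_isClosed isClosed_Icc (isClosed_Ici (a := r + 1)))
        fun s hs => hs.1) hcon
    have hbelow : ∀ s ∈ Ico t s₁, ‖Y s‖ ≤ r := by
      intro s hs
      have hsub : Icc t s ⊆ Icc t (t + P.T) := Icc_subset_Icc_right (hs.2.le.trans hs₁.2)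
      refine hnorm _ s (ht.trans hs.1) ?_
      rw [← hY0]
      refine H.V_le_of_uHat ht (fun x hx => ?_) s (right_mem_Icc.2 hs.1)
      rw [← hfield x]
      · exact (hY x (hsub hx)).mono hsub
      · by_contra! hx'
        exact absurd (hmin ⟨hsub hx, hx'.le⟩) (not_le.2 (hx.2.trans_lt hs.2))
    have : ‖Y s₁‖ ≤ r := by
      rcases hs₁.1.eq_or_lt with h | h
      · rw [← h, hY0]
        exact hnorm X₀ t ht le_rfl
      · have hne : (𝓝[Ico t s₁] s₁).NeBot := by
          rw [nhdsWithin_Ico_eq_nhdsLT h]; infer_instance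
        have hcw : ContinuousWithinAt (fun s => ‖Y s‖) (Ico t s₁) s₁ :=
          ((hYc s₁ hs₁).mono fun s hs => ⟨hs.1, hs.2.le.trans hs₁.2⟩).norm
        refine le_of_tendsto hcw.tendsto ?_
        filter_upwards [self_mem_nhdsWithin] with s hs using hbelow s hs
    linarith
  exact ⟨Y, hY0, fun s hs => hfield s (hbound s hs).le ▸ hY s hs⟩

end Standing

/-- The tracking-error dynamics with a continuous input have global solutions. -/
theorem exists_fieldAt_solution {v ω : ℝ → ℝ} (hv : Continuous v) (hω : Continuous ω)
    {u : ℝ → Fin 2 → ℝ} (hu : Continuous u) (t : ℝ) (X₀ : ErrState) :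
    ∃ Y : ℝ → ErrState, Y t = X₀ ∧ ∀ (s : ℝ) (d : ℝ × ℝ),
      HasDerivAt Y (fieldAt (Y s) (u s) (v s, ω s, d)) s := by
  have hint : ∀ {f : ℝ → ℝ}, Continuous f → ∀ s, HasDerivAt (fun s => ∫ x in t..s, f x) (f s) s :=
    fun hf s => intervalIntegral.integral_hasDerivAt_right (hf.intervalIntegrable _ _)
      (hf.stronglyMeasurableAtFilter _ _) hf.continuousAt
  have hcint : ∀ {f : ℝ → ℝ}, Continuous f → Continuous (fun s => ∫ x in t..s, f x) :=
    fun hf => continuous_iff_continuousAt.2 fun s => (hint hf s).continuousAt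
  have hu0 : Continuous fun s => u s 0 := (continuous_apply 0).comp hu
  have hu1 : Continuous fun s => u s 1 := (continuous_apply 1).comp hu
  -- For a given input, `θ` is an integral and `(x, y)` solves a linear system whose homogeneous
  -- part is rotation by `φ`. `A` and `B` come from variation of constants.
  set φ : ℝ → ℝ := fun s => ∫ x in t..s, u x 1
  have hφ : ∀ s, HasDerivAt φ (u s 1) s := hint hu1
  have hφc : Continuous φ := hcint hu1
  set θ : ℝ → ℝ := fun s => X₀ 2 + ∫ x in t..s, (ω x - u x 1)
  have hθ : ∀ s, HasDerivAt θ (ω s - u s 1) s := fun s => (hint (hω.sub hu1) s).const_add _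
  have hθc : Continuous θ := continuous_const.add (hcint (hω.sub hu1))
  set f : ℝ → ℝ := fun s => v s * cos (θ s) - u s 0
  have hf : Continuous f := by fun_prop
  set g : ℝ → ℝ := fun s => v s * sin (θ s)
  have hg : Continuous g := by fun_prop
  set A : ℝ → ℝ := fun s => X₀ 0 + ∫ x in t..s, (cos (φ x) * f x - sin (φ x) * g x)
  have hA : ∀ s, HasDerivAt A (cos (φ s) * f s - sin (φ s) * g s) s := fun s =>
    (hint (f := fun x => cos (φ x) * f x - sin (φ x) * g x) (by fun_prop) s).const_add _
  set B : ℝ → ℝ := fun s => X₀ 1 + ∫ x in t..s, (sin (φ x) * f x + cos (φ x) * g x)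
  have hB : ∀ s, HasDerivAt B (sin (φ s) * f s + cos (φ s) * g s) s := fun s =>
    (hint (f := fun x => sin (φ x) * f x + cos (φ x) * g x) (by fun_prop) s).const_add _
  refine ⟨fun s => !₂[cos (φ s) * A s + sin (φ s) * B s, -sin (φ s) * A s + cos (φ s) * B s, θ s],
    ?_, fun s d => ?_⟩
  · ext i
    fin_cases i <;> simp [φ, A, B, θ]
  · have hs := (hφ s).sin
    have hc := (hφ s).cos
    have h0 := (hc.mul (hA s)).add (hs.mul (hB s))
    have h1 := (hs.neg.mul (hA s)).add (hc.mul (hB s))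
    have h : HasDerivAt (fun s => ![cos (φ s) * A s + sin (φ s) * B s,
        -sin (φ s) * A s + cos (φ s) * B s, θ s])
        (fieldAt !₂[cos (φ s) * A s + sin (φ s) * B s, -sin (φ s) * A s + cos (φ s) * B s, θ s]
          (u s) (v s, ω s, d)).ofLp s := by
      have e := sin_sq_add_cos_sq (φ s)
      rw [hasDerivAt_pi]
      intro i
      fin_cases i
      · refine h0.congr_deriv ?_
        simp only [fieldAt, Fin.zero_eta, Matrix.cons_val]
        linear_combination (f s) * e
      · refine h1.congr_deriv ?_
        simp only [fieldAt, Fin.mk_one, Matrix.cons_val, Pi.neg_apply]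
        linear_combination (g s) * e
      · exact hθ s
    exact (PiLp.continuousLinearEquiv 2 ℝ fun _ : Fin 3 => ℝ).symm.hasFDerivAt.comp_hasDerivAt s h

theorem RefInputs.Admissible.exists_errField_solution {R : RefInputs} {M c : ℝ}
    (hR : R.Admissible M c) {u : ℝ → Fin 2 → ℝ} (hu : Continuous u) (t : ℝ) (X₀ : ErrState) :
    ∃ Y : ℝ → ErrState, Y t = X₀ ∧ ∀ s, 0 ≤ s → HasDerivAt Y (errField R (Y s) (u s) s) s := by
  have ext : ∀ {f : ℝ → ℝ}, DifferentiableOn ℝ f (Ici 0) → Continuous fun s => f (max s 0) :=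
    fun hf => hf.continuousOn.comp_continuous (by fun_prop) fun s => le_max_right s 0
  obtain ⟨Y, hY0, hY⟩ := exists_fieldAt_solution (ext hR.diff_v) (ext hR.diff_ω) hu t X₀
  refine ⟨Y, hY0, fun s hs => ?_⟩
  have := hY s (R.dv s, R.dω s)
  rw [max_eq_left hs] at this
  rwa [errField_eq]

namespace Standing

variable {P : Params} {R : RefInputs} {M c α : ℝ}

/-- Rules out an event at the very start of a period, so that a first event time strictly after it
exists as the minimum of a closed set. -/
theorem not_trigger_uHat (H : Standing P R M c α) (X : ErrState) {t : ℝ} (ht : 0 ≤ t) :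
    ¬ P.Trigger R X (P.uHat R X t) t := by
  rintro ⟨h1, h2⟩
  rw [H.Vdot_uHat X ht] at h1
  have := H.le_Sig X t ht h2
  nlinarith [H.σ_lt, H.α_pos]

theorem isClosed_trigger (H : Standing P R M c α) {Y : ℝ → ErrState} {u : ℝ → Fin 2 → ℝ} {t : ℝ}
    (ht : 0 ≤ t) (hY : ContinuousOn Y (Ici t)) (hu : Continuous u) :
    IsClosed {s | t ≤ s ∧ P.Trigger R (Y s) (u s) s} := by
  have hsig : ContinuousOn R.signal (Ici t) :=
    H.cont_signal.continuousOn.mono (Ici_subset_Ici.2 ht)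
  have hVdot : ContinuousOn (fun s => P.VdotAt (Y s) (u s) (R.signal s)) (Ici t) := by
    have := Params.continuous_VdotAt (P := P)
    fun_prop
  have hSig : ContinuousOn (fun s => P.SigAt (Y s) (R.signal s)) (Ici t) := by
    have := Params.continuous_SigAt (P := P)
    fun_prop
  have hV : ContinuousOn (fun s => P.VAt (Y s) (R.signal s)) (Ici t) := by
    have := Params.continuous_VAt (P := P)
    fun_prop
  have h1 := (hVdot.sub (hSig.const_mul (-P.σ))).preimage_isClosed_of_isClosed
    isClosed_Ici (isClosed_Ici (a := (0 : ℝ)))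
  have h2 := hV.preimage_isClosed_of_isClosed isClosed_Ici (isClosed_Ici (a := P.ε ^ 2))
  have e : {s | t ≤ s ∧ P.Trigger R (Y s) (u s) s} =
      (Ici t ∩ (fun s => P.VdotAt (Y s) (u s) (R.signal s) - -P.σ * P.SigAt (Y s) (R.signal s)) ⁻¹'
        Ici 0) ∩ (Ici t ∩ (fun s => P.VAt (Y s) (R.signal s)) ⁻¹' Ici (P.ε ^ 2)) := by
    ext s
    simp only [mem_inter_iff, mem_preimage, mem_Ici, Params.Trigger, mem_ofPred_eq, Params.V_eq,
      Params.Sig_eq, sub_nonneg]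
    by_cases hs : t ≤ s
    · simp only [hs, true_and, Params.Vdot_eq H.adm H.γ_pos.ne' _ (ht.trans hs)]
    · simp only [hs, false_and]
  rw [e]
  exact h1.inter h2

/-- One period of the closed loop between two events, started at time `t` with error `X₀`. -/
theorem exists_period (H : Standing P R M c α) {t : ℝ} (ht : 0 ≤ t) (X₀ : ErrState) :
    ∃ (Xh : ℝ → ErrState) (a : Fin 2 → P.Coeffs) (Y : ℝ → ErrState) (t' : ℝ),
      Xh t = X₀ ∧ Y t = X₀ ∧ t < t' ∧
      (∀ s ∈ Icc t (t + P.T), HasDerivWithinAt Xh (errField R (Xh s) (P.uHat R (Xh s) s) s)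
        (Icc t (t + P.T)) s) ∧
      (∀ i, P.IsBestFit (P.δ i) (fun τ => P.uHat R (Xh (t + τ)) (t + τ) i) (a i)) ∧
      (∀ s, t ≤ s → HasDerivAt Y (errField R (Y s) (fun i => P.poly (a i) (s - t)) s) s) ∧
      ((∃ s, t < s ∧ P.Trigger R (Y s) (fun i => P.poly (a i) (s - t)) s) →
        IsLeast {s | t < s ∧ P.Trigger R (Y s) (fun i => P.poly (a i) (s - t)) s} t') := by
  obtain ⟨Xh, hXh0, hXh⟩ := H.exists_uHat_solution ht X₀
  choose a ha using fun i => Params.exists_isBestFit H.T_pos (H.δ_nonneg i)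
    (H.continuousOn_uHat_shift ht (fun s hs => (hXh s hs).continuousWithinAt) i)
  have hu : Continuous fun s => fun i => P.poly (a i) (s - t) :=
    continuous_pi fun i => (Params.continuous_poly_right (a i)).comp (by fun_prop)
  obtain ⟨Y, hY0, hY⟩ := H.adm.exists_errField_solution hu t X₀
  have hY' : ∀ s, t ≤ s → HasDerivAt Y (errField R (Y s) (fun i => P.poly (a i) (s - t)) s) s :=
    fun s hs => hY s (ht.trans hs)
  have hu0 : (fun i => P.poly (a i) (t - t)) = P.uHat R (Y t) t := by
    funext i
    simpa [hXh0, hY0] using (ha i).1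
  have hset : {s | t < s ∧ P.Trigger R (Y s) (fun i => P.poly (a i) (s - t)) s}
      = {s | t ≤ s ∧ P.Trigger R (Y s) (fun i => P.poly (a i) (s - t)) s} := by
    ext s
    refine ⟨fun h => ⟨h.1.le, h.2⟩, fun h => ⟨h.1.lt_of_ne ?_, h.2⟩⟩
    rintro rfl
    exact H.not_trigger_uHat _ ht (hu0 ▸ h.2)
  have hcl := H.isClosed_trigger ht (fun s hs => (hY' s hs).continuousAt.continuousWithinAt) hu
  by_cases hE : ∃ s, t < s ∧ P.Trigger R (Y s) (fun i => P.poly (a i) (s - t)) s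
  · have hE' : {s | t ≤ s ∧ P.Trigger R (Y s) (fun i => P.poly (a i) (s - t)) s}.Nonempty :=
      hset ▸ hE
    have hl := hcl.isLeast_csInf hE' ⟨t, fun s hs => hs.1⟩
    rw [← hset] at hl
    exact ⟨Xh, a, Y, _, hXh0, hY0, hl.1.1, hXh, ha, hY', fun _ => hl⟩
  · exact ⟨Xh, a, Y, t + 1, hXh0, hY0, by linarith, hXh, ha, hY', fun h => absurd h hE⟩

end Standing

/-- Distinct arcs meet only if consecutive, and then only at the event time, where the pieces agree.
-/
theorem exists_glue {E : Type*} [Inhabited E] {N : ℕ∞} {t : ℕ → ℝ} (ht : StrictMono t)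
    (Y : ℕ → ℝ → E) (hY : ∀ k, Y (k + 1) (t (k + 1)) = Y k (t (k + 1))) :
    ∃ X : ℝ → E, ∀ k : ℕ, (k : ℕ∞) ≤ N → EqOn X (Y k) (arc N t k) := by
  classical
  have key : ∀ j k : ℕ, j < k → (k : ℕ∞) ≤ N → ∀ s ∈ arc N t j, s ∈ arc N t k → Y j s = Y k s := by
    intro j k hjk hk s hj hs
    have h1 : s ≤ t (j + 1) := hj.2 (lt_of_lt_of_le (by exact_mod_cast hjk) hk)
    have h2 : t k ≤ t (j + 1) := hs.1.trans h1
    obtain rfl : k = j + 1 := le_antisymm (ht.le_iff_le.1 h2) hjk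
    obtain rfl : s = t (j + 1) := le_antisymm h1 hs.1
    exact (hY j).symm
  refine ⟨fun s => if h : ∃ k : ℕ, (k : ℕ∞) ≤ N ∧ s ∈ arc N t k then Y h.choose s else default,
    fun k hk s hs => ?_⟩
  have h : ∃ k : ℕ, (k : ℕ∞) ≤ N ∧ s ∈ arc N t k := ⟨k, hk, hs⟩
  simp only [dif_pos h]
  obtain ⟨hj, hjs⟩ := h.choose_spec
  rcases lt_trichotomy h.choose k with h' | h' | h'
  · exact key _ _ h' hk s hjs hs
  · rw [h']
  · exact (key _ _ h' hj s hs hjs).symm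

theorem exists_enat_first (p : ℕ → Prop) :
    ∃ N : ℕ∞, (∀ k : ℕ, (k : ℕ∞) < N → p k) ∧ ∀ k : ℕ, (k : ℕ∞) = N → ¬ p k := by
  classical
  by_cases h : ∃ k, ¬ p k
  · refine ⟨(Nat.find h : ℕ), fun k hk => ?_, fun k hk => ?_⟩
    · exact not_not.1 (Nat.find_min h (by exact_mod_cast hk))
    · obtain rfl : k = Nat.find h := by exact_mod_cast hk
      exact Nat.find_spec h
  · push Not at h
    exact ⟨⊤, fun k _ => h k, fun k hk => absurd hk (ENat.natCast_ne_top k)⟩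

/-- Closed-loop trajectories exist from every initial time and initial error. -/
theorem Standing.exists_closedLoop {P : Params} {R : RefInputs} {M c α : ℝ}
    (H : Standing P R M c α) {t₀ : ℝ} (ht₀ : 0 ≤ t₀) (X₀ : ErrState) :
    ∃ S : ClosedLoop P R t₀, S.X t₀ = X₀ := by
  choose Xh a Y t' hXh0 hY0 hlt hXh ha hY hev using
    fun z : {z : ℝ × ErrState // 0 ≤ z.1} => H.exists_period z.2 z.1.2
  let st : ℕ → {z : ℝ × ErrState // 0 ≤ z.1} := fun k =>
    Nat.rec ⟨(t₀, X₀), ht₀⟩ (fun _ z => ⟨(t' z, Y z (t' z)), z.2.trans (hlt z).le⟩) k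
  let t : ℕ → ℝ := fun k => (st k).1.1
  have ht : StrictMono t := strictMono_nat_of_lt_succ fun k => hlt (st k)
  obtain ⟨N, hN1, hN2⟩ := exists_enat_first fun k => ∃ s, t k < s ∧
    P.Trigger R (Y (st k) s) (fun i => P.poly (a (st k) i) (s - t k)) s
  obtain ⟨X, hX⟩ := exists_glue (N := N) ht (fun k => Y (st k)) fun k => hY0 (st (k + 1))
  have hleft : ∀ k : ℕ, t k ∈ arc N t k := fun k => ⟨le_rfl, fun _ => (ht k.lt_succ_self).le⟩
  have hXt : ∀ k : ℕ, (k : ℕ∞) ≤ N → X (t k) = (st k).1.2 := fun k hk =>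
    (hX k hk (hleft k)).trans (hY0 (st k))
  refine ⟨{ N := N, t := t, X := X, Xhat := fun k => Xh (st k), a := fun k => a (st k),
            t_zero := rfl
            Xhat_init := fun k hk => (hXh0 (st k)).trans (hXt k hk).symm
            Xhat_ode := fun k _ => hXh (st k)
            a_fit := fun k _ => ha (st k)
            X_ode := fun k hk s hs => ?_
            next_event := fun k hk => ?_
            last_event := fun k hk s hs hT => ?_ }, hXt 0 (by simp)⟩
  · rw [hX k hk hs]
    exact (hY (st k) s hs.1).hasDerivWithinAt.congr (fun r hr => hX k hk hr) (hX k hk hs)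
  · obtain ⟨h1, h2⟩ := hev (st k) (hN1 k hk)
    have hmem : t (k + 1) ∈ arc N t k := ⟨(ht k.lt_succ_self).le, fun _ => le_rfl⟩
    refine ⟨⟨hmem, ht k.lt_succ_self, ?_⟩, fun s hs => h2 ⟨hs.2.1, ?_⟩⟩
    · rw [hX k hk.le hmem]
      exact h1.2
    · rw [← hX k hk.le hs.1]
      exact hs.2.2
  · have hmem : s ∈ arc N t k := ⟨hs.le, fun h => absurd hk h.ne⟩
    rw [hX k hk.le hmem] at hT
    exact hN2 k hk ⟨s, hs, hT⟩

/-! ### Uniformity in the initial error and the conclusion. -/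

namespace Standing

variable {P : Params} {R : RefInputs} {M c α : ℝ}

/-- From a time that depends only on the initial error bound on, `V ≤ ε²`. -/
theorem exists_time_V_le (H : Standing P R M c α) (ρ : ℝ) :
    ∃ D : ℝ, 0 ≤ D ∧ ∀ t₀ : ℝ, 0 ≤ t₀ → ∀ S : ClosedLoop P R t₀, ‖S.X t₀‖ ≤ ρ →
      ∀ k : ℕ, (k : ℕ∞) ≤ S.N → ∀ s ∈ arc S.N S.t k, t₀ + D ≤ s → P.V R (S.X s) s ≤ P.ε ^ 2 := by
  obtain ⟨m, hm⟩ := H.exists_V_le ρ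
  have hσα := mul_pos H.σ_pos H.α_pos
  -- Decreasing at rate `σ α` from at most `m`, the first bound in `V_le` is nonpositive after time
  -- `m / (σ α)`.
  refine ⟨max 0 (m / (P.σ * α)), le_max_left _ _, fun t₀ ht₀ S hS k hk s hs hD => ?_⟩
  refine (S.V_le H ht₀ hk hs).trans (max_le ?_ le_rfl)
  have h1 := hm _ t₀ ht₀ hS
  have h2 : m / (P.σ * α) ≤ s - t₀ := by linarith [le_max_right 0 (m / (P.σ * α))]
  rw [div_le_iff₀' hσα] at h2
  nlinarith [sq_nonneg P.ε]

theorem exists_gap_of_norm_le (H : Standing P R M c α) (ρ : ℝ) :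
    ∃ τ : ℝ, 0 < τ ∧ ∀ t₀ : ℝ, 0 ≤ t₀ → ∀ S : ClosedLoop P R t₀, ‖S.X t₀‖ ≤ ρ →
      ∀ k : ℕ, (k : ℕ∞) < S.N → τ ≤ S.t (k + 1) - S.t k := by
  obtain ⟨m, hm⟩ := H.exists_V_le ρ
  obtain ⟨τ, hτ, h⟩ := H.exists_gap (max m (P.ε ^ 2))
  refine ⟨τ, hτ, fun t₀ ht₀ S hS k hk => h t₀ ht₀ S k hk ?_⟩
  refine (S.V_le_event H ht₀ hk.le).trans (max_le_max ?_ le_rfl)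
  have := mul_nonneg (mul_pos H.σ_pos H.α_pos).le (sub_nonneg.2 (S.t₀_le_t hk.le))
  linarith [hm _ t₀ ht₀ hS]

end Standing

namespace ClosedLoop

variable {P : Params} {R : RefInputs} {t₀ : ℝ} (S : ClosedLoop P R t₀)

theorem mul_le_t_sub {τ : ℝ} (h : ∀ k : ℕ, (k : ℕ∞) < S.N → τ ≤ S.t (k + 1) - S.t k) (k : ℕ)
    (hk : (k : ℕ∞) ≤ S.N) : k * τ ≤ S.t k - t₀ := by
  induction k with
  | zero => simp [S.t_zero]
  | succ k ih =>
    have hk' : (k : ℕ∞) < S.N := lt_of_lt_of_le (by exact_mod_cast k.lt_succ_self) hk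
    have := ih hk'.le
    have := h k hk'
    push_cast
    linarith

/-- If the inter-event times are bounded below, then the arcs cover `[t₀, ∞)`. -/
theorem exists_mem_arc {τ : ℝ} (hτ : 0 < τ)
    (h : ∀ k : ℕ, (k : ℕ∞) < S.N → τ ≤ S.t (k + 1) - S.t k) {s : ℝ} (hs : t₀ ≤ s) :
    ∃ k : ℕ, (k : ℕ∞) ≤ S.N ∧ s ∈ arc S.N S.t k := by
  by_contra! hcon
  have key : ∀ k : ℕ, (k : ℕ∞) ≤ S.N ∧ S.t k ≤ s := by
    intro k
    induction k with
    | zero => exact ⟨by simp, S.t_zero.trans_le hs⟩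
    | succ k ih =>
      have := hcon k ih.1
      simp only [arc, mem_ofPred_eq, not_and, Classical.not_imp, not_le] at this
      obtain ⟨h1, h2⟩ := this ih.2
      exact ⟨by exact_mod_cast Order.add_one_le_of_lt h1, h2.le⟩
  obtain ⟨n, hn⟩ := exists_nat_gt ((s - t₀) / τ)
  rw [div_lt_iff₀ hτ] at hn
  have := S.mul_le_t_sub h n (key n).1
  linarith [(key n).2]

end ClosedLoop

end

theorem mainTheorem1
    (M c c₁ c₂ c₃ ε : ℝ) (hM : 0 ≤ M) (hc : 0 < c)
    (hc₁ : 0 < c₁) (hc₂ : 0 < c₂) (hc₃ : 0 < c₃) (hε : 0 < ε) :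
    ∃ γ₀ : ℝ, 0 < γ₀ ∧ ∀ γ : ℝ, γ₀ ≤ γ →
      ∀ (σ T : ℝ) (δ : Fin 2 → ℝ) (p : ℕ), 0 < σ → σ < 1 → 0 < T → (∀ i, 0 ≤ δ i) →
      ∀ R : RefInputs, R.Admissible M c →
        UniformContinuousOn R.dv (Set.Ici 0) → UniformContinuousOn R.dω (Set.Ici 0) →
      -- closed-loop trajectories exist from every initial time and initial error
      (∀ t₀ : ℝ, 0 ≤ t₀ → ∀ X₀ : ErrState, ∃ S : ClosedLoop ⟨c₁, c₂, c₃, γ, σ, ε, T, δ, p⟩ R t₀, S.X t₀ = X₀) ∧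
      -- uniform lower bound on the inter-event times, depending on the initial error bound
      (∀ ρ : ℝ, ∃ τ : ℝ, 0 < τ ∧
        ∀ t₀ : ℝ, 0 ≤ t₀ → ∀ S : ClosedLoop ⟨c₁, c₂, c₃, γ, σ, ε, T, δ, p⟩ R t₀, ‖S.X t₀‖ ≤ ρ →
          ∀ k : ℕ, (k : ℕ∞) < S.N → τ ≤ S.t (k + 1) - S.t k) ∧
      -- after a finite time and finitely many events, a bound independent of the initial error
      (∃ τ : ℝ, 0 < τ ∧ ∀ ρ : ℝ, ∃ (D : ℝ) (K : ℕ), 0 ≤ D ∧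
        ∀ t₀ : ℝ, 0 ≤ t₀ → ∀ S : ClosedLoop ⟨c₁, c₂, c₃, γ, σ, ε, T, δ, p⟩ R t₀, ‖S.X t₀‖ ≤ ρ →
          ∀ k : ℕ, (k : ℕ∞) < S.N → (t₀ + D ≤ S.t k ∨ K ≤ k) → τ ≤ S.t (k + 1) - S.t k) ∧
      -- uniform ultimate boundedness of the tracking error
      (∃ b : ℝ, 0 < b ∧ ∀ ρ : ℝ, ∃ D : ℝ, 0 ≤ D ∧
        ∀ t₀ : ℝ, 0 ≤ t₀ → ∀ S : ClosedLoop ⟨c₁, c₂, c₃, γ, σ, ε, T, δ, p⟩ R t₀, ‖S.X t₀‖ ≤ ρ →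
          ∀ s : ℝ, t₀ + D ≤ s → ‖S.X s‖ ≤ b) := by
  obtain ⟨γ₀, α, hγ₀, hα, hSig⟩ := Params.exists_SigAt_lower_bound hM hc hc₁ hc₂ hc₃ hε
  refine ⟨γ₀, hγ₀, fun γ hγ σ T δ p hσ hσ1 hT hδ R hR hdv hdω => ?_⟩
  set P : Params := ⟨c₁, c₂, c₃, γ, σ, ε, T, δ, p⟩ with hP
  have H : Standing P R M c α :=
    { γ_pos := hγ₀.trans_le hγ
      σ_pos := hσ
      σ_lt := hσ1
      T_pos := hT
      δ_nonneg := hδ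
      adm := hR
      cont_signal := hR.uniformContinuousOn_signal hdv hdω
      α_pos := hα
      le_Sig := fun X t ht hV => hSig P rfl rfl rfl hγ X (R.signal t) (hR.lower_v t ht)
        (hR.bound_ω t ht) hV
      Sig_nonneg := fun X t => by
        simp only [Params.Sig, hP]
        positivity }
  refine ⟨fun t₀ ht₀ X₀ => H.exists_closedLoop ht₀ X₀, H.exists_gap_of_norm_le, ?_, ?_⟩
  -- `τ` is fixed before `ρ`: the level `ε²` does not involve the initial error.
  · obtain ⟨τ, hτ, hgap⟩ := H.exists_gap (ε ^ 2)
    refine ⟨τ, hτ, fun ρ => ?_⟩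
    obtain ⟨τ', hτ', hgap'⟩ := H.exists_gap_of_norm_le ρ
    obtain ⟨D, hD, hV⟩ := H.exists_time_V_le ρ
    -- Events are at least `τ'` apart, so the event `K` comes no earlier than `t₀ + D`.
    obtain ⟨K, hK⟩ := exists_nat_ge (D / τ')
    rw [div_le_iff₀ hτ'] at hK
    refine ⟨D, K, hD, fun t₀ ht₀ S hS k hk hlate => hgap t₀ ht₀ S k hk ?_⟩
    refine hV t₀ ht₀ S hS k hk.le _ (S.left_mem_arc hk.le) ?_
    rcases hlate with h | h
    · exact h
    · have h1 := S.mul_le_t_sub (hgap' t₀ ht₀ S hS) k hk.le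
      have h2 : (K : ℝ) * τ' ≤ k * τ' := by gcongr
      linarith
  · obtain ⟨b, hb, hnorm⟩ := H.exists_norm_le (ε ^ 2)
    refine ⟨b, hb, fun ρ => ?_⟩
    obtain ⟨τ, hτ, hgap⟩ := H.exists_gap_of_norm_le ρ
    obtain ⟨D, hD, hV⟩ := H.exists_time_V_le ρ
    refine ⟨D, hD, fun t₀ ht₀ S hS s hs => ?_⟩
    -- Events do not accumulate, so every late time lies in some arc.
    obtain ⟨k, hk, hks⟩ := S.exists_mem_arc hτ (hgap t₀ ht₀ S hS) (by linarith : t₀ ≤ s)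
    exact hnorm _ s (by linarith) (hV t₀ ht₀ S hS k hk s hks hs)
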